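/- Let $e$ be a positive integer and let $q = 3^{2e}$. Then there exists a set $\mathcal{K}$ of points of the Desarguesian affine plane $\mathrm{AG}(2,q)$ (whose points are the elements of $\mathbb{F}_q^2$ and whose lines are the one-dimensional affine subspaces of $\mathbb{F}_q^2$) with $$|\mathcal{K}| = \frac{3^{4e}-3^{2e}}{2},$$ such that $\mathcal{K}$ is a set of type $\left(\frac{1}{2}(3^{2e}-3^{e}),\ \frac{1}{2}(3^{2e}+3^{e})\right)$; that is, every line of $\mathrm{AG}(2,q)$ contains either exactly $\frac{1}{2}(3^{2e}-3^{e})$ or exactly $\frac{1}{2}(3^{2e}+3^{e})$ points of $\mathcal{K}$, and both of these values occur. -/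

import Mathlib

/-- The point set of the affine space `AG(d, F)` over the field `F`: the vector space `F^d`,
regarded as an affine space over itself. -/
abbrev AG (d : ℕ) (F : Type*) : Type _ := Fin d → F

/-- A line of `AG(d, F)`: an affine subspace of dimension one. (The empty affine subspace has
direction `⊥`, of dimension `0`, so a line is automatically non-empty.) -/
def IsLine {d : ℕ} {F : Type*} [Field F] (l : AffineSubspace F (AG d F)) : Prop :=
  Module.finrank F l.direction = 1

/-- A set of type `(m, n)` in `AG(d, F)`: `m < n`, every line contains either `m` or `n` points of
`K`, and both values occur. -/
def IsSetOfType {d : ℕ} {F : Type*} [Field F] (m n : ℕ) (K : Set (AG d F)) : Prop :=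
  m < n ∧
  (∀ l : AffineSubspace F (AG d F), IsLine l →
    (K ∩ (l : Set (AG d F))).ncard = m ∨ (K ∩ (l : Set (AG d F))).ncard = n) ∧
  (∃ l : AffineSubspace F (AG d F), IsLine l ∧ (K ∩ (l : Set (AG d F))).ncard = m) ∧
  (∃ l : AffineSubspace F (AG d F), IsLine l ∧ (K ∩ (l : Set (AG d F))).ncard = n)

set_option linter.unusedSectionVars false

universe u

/-! Write q = 9^e, let L be the cubic extension of F, and take as plane the hyperplane of trace 1 in
L. Let χ be a quartic character of F with values in a field containing i, and let θ be 1 where χ is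
1 or i, and -1 where χ is -1 or -i. The set, up to complement, is where θ(N(y)) = 1.

The total of the signs is ±q. The Gauss sum over L of χ ∘ N is the trace-one sum of χ ∘ N times a
Gauss sum over F, so the trace-one sums of χ and χ⁻¹ have product q²
(`sum_trace_eq_one_mul_sum_trace_eq_one`). They are equal, because y ↦ y³ preserves the hyperplane
and χ³ = χ⁻¹ (`sum_trace_eq_one_pow_three`).

A total of ±q makes the mean square of the line sums exactly q. Line sums are odd, so if all are
divisible by 3^e, all squares are at least q and hence equal to q (`sq_sum_add_smul_eq`). Each line
then has sum ±3^e, which gives the two intersection numbers.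

Divisibility by 3^e is the arithmetic core. On a line the norm is a genuine cubic polynomial. After
multiplication by a Gauss sum, Frobenius invariance of ψ lowers the exponent to degree 2 in the line
parameter; completing the square leaves a twisted Kloosterman sum
(`valuation_sum_mulChar_cubic_le`). This expands into products of Gauss sums of ω^j and ω^(j +
(q-1)/4), with ω the inverse Teichmüller character. Stickelberger's bound
(`valuation_gaussSum_invTeichmuller_le`) and a count of ternary digits
(`Nat.digits_three_sum_add_quarter`) make each product divisible by 3^e. -/

/-! ### A 3-adic valuation on an algebraically closed field. -/

theorem WittVector.charZero (F : Type*) [Field F] [PerfectRing F 3] [CharP F 3] :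
    CharZero (WittVector 3 F) := by
  have h3 : (3 : WittVector 3 F) ≠ 0 := by
    simpa using (WittVector.irreducible 3 (k := F)).ne_zero
  obtain ⟨p, hp⟩ := CharP.exists (WittVector 3 F)
  rcases CharP.char_is_prime_or_zero (WittVector 3 F) p with h | rfl
  · have h0 : ((p : ℕ) : F) = 0 := by
      have := congrArg WittVector.constantCoeff (CharP.cast_eq_zero (WittVector 3 F) p)
      rwa [map_natCast, map_zero] at this
    have h1 : 3 ∣ p := (CharP.cast_eq_zero_iff F 3 p).1 h0
    obtain rfl := (Nat.prime_dvd_prime_iff_eq Nat.prime_three h).1 h1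
    exact absurd (by simpa using CharP.cast_eq_zero (WittVector 3 F) 3) h3
  · exact CharP.charP_to_charZero _

/-- The Witt vectors of a finite field of characteristic `3` map to an algebraically closed field
of characteristic zero with a valuation that is at most one on the image and less than one
at `3`. -/
theorem WittVector.exists_valuation (F : Type u) [Field F] [Finite F] [CharP F 3] :
    ∃ (C : Type u) (_ : Field C) (_ : CharZero C) (_ : IsAlgClosed C) (Γ : Type u)
      (_ : LinearOrderedCommGroupWithZero Γ) (v : Valuation C Γ)
      (φ : WittVector 3 F →+* C), v 3 < 1 ∧ ∀ w, v (φ w) ≤ 1 := by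
  have : PerfectRing F 3 := inferInstance
  let K := FractionRing (WittVector 3 F)
  let C := AlgebraicClosure K
  let φ : WittVector 3 F →+* C := (algebraMap K C).comp (algebraMap _ K)
  have h3 : ¬ IsUnit (3 : WittVector 3 F) := by
    simpa using (WittVector.irreducible 3 (k := F)).not_isUnit
  -- The valuation ring dominates the Witt vectors: locality of the map keeps 3 a non-unit, whence
  -- `v 3 < 1`.
  obtain ⟨B, hB, hloc⟩ := IsLocalRing.exists_factor_valuationRing φ
  have : CharZero (WittVector 3 F) := WittVector.charZero F
  have : CharZero K :=
    charZero_of_injective_algebraMap (IsFractionRing.injective (WittVector 3 F) K)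
  have : CharZero C := charZero_of_injective_algebraMap (algebraMap K C).injective
  refine ⟨C, inferInstance, inferInstance, inferInstance, B.ValueGroup, inferInstance,
    B.valuation, φ, ?_, fun w => (B.valuation_le_one_iff _).2 (hB w)⟩
  have h := (B.valuation_lt_one_iff (φ.codRestrict B.toSubring hB 3)).1
    ((IsLocalRing.mem_maximalIdeal _).2 fun hu => h3 (hloc.1 _ hu))
  have e : ((φ.codRestrict B.toSubring hB 3 : B) : C) = 3 := by
    change φ 3 = 3
    exact map_ofNat φ 3
  rwa [e] at h

theorem Valuation.map_eq_one_of_pow_eq_one {C Γ : Type*} [Ring C]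
    [LinearOrderedCommGroupWithZero Γ] (v : Valuation C Γ) {x : C} {n : ℕ} (hn : n ≠ 0)
    (h : x ^ n = 1) : v x = 1 := by
  have : v x ^ n = 1 := by rw [← map_pow, h, map_one]
  exact (pow_eq_one_iff.1 this).resolve_right hn

theorem Valuation.map_eq_one_of_constantCoeff_ne_zero {F C Γ : Type*} [Field F] [CharP F 3]
    [Field C] [LinearOrderedCommGroupWithZero Γ] (v : Valuation C Γ) (φ : WittVector 3 F →+* C)
    (hφ : ∀ w, v (φ w) ≤ 1) {w : WittVector 3 F} (hw : WittVector.constantCoeff w ≠ 0) :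
    v (φ w) = 1 := by
  obtain ⟨u, rfl⟩ := WittVector.isUnit_of_coeff_zero_ne_zero w hw
  have h : v (φ u) * v (φ (u⁻¹ : (WittVector 3 F)ˣ)) = 1 := by
    rw [← map_mul, ← map_mul, Units.mul_inv, map_one, map_one]
  refine le_antisymm (hφ _) ?_
  calc (1 : Γ) = v (φ u) * v (φ (u⁻¹ : (WittVector 3 F)ˣ)) := h.symm
    _ ≤ v (φ u) * 1 := mul_le_mul_right (hφ _) _
    _ = _ := mul_one _

theorem Valuation.natCast_eq_one_of_not_dvd {F C Γ : Type*} [Field F] [CharP F 3]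
    [Field C] [LinearOrderedCommGroupWithZero Γ] (v : Valuation C Γ) (φ : WittVector 3 F →+* C)
    (hφ : ∀ w, v (φ w) ≤ 1) {n : ℕ} (hn : ¬ 3 ∣ n) : v (n : C) = 1 := by
  have h := v.map_eq_one_of_constantCoeff_ne_zero φ hφ (w := (n : WittVector 3 F)) (by
    simpa using fun h => hn ((CharP.cast_eq_zero_iff F 3 n).1 h))
  simpa using h

/-- The way back from valuations to integers: the part of n prime to 3 has valuation 1. As `v` is
multiplicative, a small value means high divisibility. -/
theorem Valuation.pow_dvd_of_le {F C Γ : Type*} [Field F] [CharP F 3]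
    [Field C] [LinearOrderedCommGroupWithZero Γ] (v : Valuation C Γ) (φ : WittVector 3 F →+* C)
    (hφ : ∀ w, v (φ w) ≤ 1) (h3 : v 3 < 1) (h30 : v 3 ≠ 0) {n : ℤ} {e : ℕ}
    (h : v (n : C) ≤ v 3 ^ e) : (3 : ℤ) ^ e ∣ n := by
  rcases eq_or_ne n 0 with rfl | hn
  · exact dvd_zero _
  have key : v (n.natAbs : C) = v (n : C) := by
    rcases Int.natAbs_eq n with h | h
    · conv_rhs => rw [h]
      simp
    · conv_rhs => rw [h]
      simp [Valuation.map_neg]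
  obtain ⟨k, m, hm, hk⟩ := Nat.exists_eq_pow_mul_and_not_dvd (Int.natAbs_ne_zero.2 hn) 3 (by norm_num)
  have hv : v (n : C) = v 3 ^ k := by
    rw [← key, hk]
    push_cast
    rw [map_mul, map_pow, v.natCast_eq_one_of_not_dvd φ hφ hm, mul_one]
  have hek : e ≤ k := by
    by_contra hlt
    push Not at hlt
    rw [hv] at h
    exact absurd h (not_le.2 (pow_lt_pow_right_of_lt_one₀ (zero_lt_iff.2 h30) h3 hlt))
  refine (pow_dvd_pow 3 hek).trans ?_
  rw [← Int.dvd_natAbs, hk]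
  exact ⟨m, by push_cast; ring⟩

/-! ### Gauss and Jacobi sums of Teichmüller powers; Stickelberger's bound. -/

/-- The inverse of the Teichmüller character, with values in a ring over the Witt vectors. -/
noncomputable def invTeichmuller {F C : Type*} [Field F] [CommRing C]
    (φ : WittVector 3 F →+* C) : MulChar F C where
  toFun x := φ (WittVector.teichmuller 3 x⁻¹)
  map_one' := by simp
  map_mul' x y := by simp [mul_comm]
  map_nonunit' x hx := by
    obtain rfl : x = 0 := by simpa using hx
    simp

theorem invTeichmuller_apply {F C : Type*} [Field F] [CommRing C]
    (φ : WittVector 3 F →+* C) (x : F) :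
    invTeichmuller φ x = φ (WittVector.teichmuller 3 x⁻¹) := rfl

theorem invTeichmuller_pow_apply {F C : Type*} [Field F] [CommRing C]
    (φ : WittVector 3 F →+* C) {j : ℕ} (hj : j ≠ 0) (x : F) :
    (invTeichmuller φ ^ j) x = φ (WittVector.teichmuller 3 (x⁻¹ ^ j)) := by
  rw [MulChar.pow_apply' _ hj, invTeichmuller_apply, map_pow, map_pow]

theorem Valuation.mulChar_le_one {F C Γ : Type*} [Field F] [Fintype F] [Field C]
    [LinearOrderedCommGroupWithZero Γ] (v : Valuation C Γ) (χ : MulChar F C) (x : F) :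
    v (χ x) ≤ 1 := by
  classical
  by_cases hx : x = 0
  · simp [hx, MulChar.map_zero]
  · refine (v.map_eq_one_of_pow_eq_one (n := Fintype.card F - 1) ?_ ?_).le
    · have := Fintype.one_lt_card (α := F)
      omega
    · rw [← map_pow, FiniteField.pow_card_sub_one_eq_one x hx, map_one]

theorem AddChar.pow_three_eq_one {F C : Type*} [Field F] [CharP F 3] [Field C] (ψ : AddChar F C) (x : F) :
    ψ x ^ 3 = 1 := by
  rw [← AddChar.map_nsmul_eq_pow]
  simp [CharP.ofNat_eq_zero F 3]

section

variable {F C Γ : Type*} [Field F] [Fintype F] [CharP F 3] [Field C]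
  [LinearOrderedCommGroupWithZero Γ]

theorem gaussSum_pow_three (χ : MulChar F C) {ψ : AddChar F C} (hψ : ∀ x, ψ (x ^ 3) = ψ x) :
    gaussSum (χ ^ 3) ψ = gaussSum χ ψ := by
  have hb : Function.Bijective (frobenius F 3) := PerfectRing.bijective_frobenius
  unfold gaussSum
  rw [← hb.sum_comp fun x => χ x * ψ x]
  refine Finset.sum_congr rfl fun x _ => ?_
  rw [frobenius_def, hψ, MulChar.pow_apply' _ (by norm_num), map_pow]

theorem Valuation.addChar_eq_one (v : Valuation C Γ) (ψ : AddChar F C) (x : F) : v (ψ x) = 1 :=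
  v.map_eq_one_of_pow_eq_one three_ne_zero (ψ.pow_three_eq_one x)

theorem Valuation.gaussSum_le_one (v : Valuation C Γ) (χ : MulChar F C) (ψ : AddChar F C) :
    v (gaussSum χ ψ) ≤ 1 := by
  refine v.map_sum_le fun x _ => ?_
  rw [map_mul, v.addChar_eq_one, mul_one]
  exact v.mulChar_le_one χ x

theorem Valuation.sub_one_sq_of_pow_three (v : Valuation C Γ) {y : C} (hy : y ^ 3 = 1)
    (h1 : y ≠ 1) : v (y - 1) ^ 2 = v 3 := by
  have h : (y - 1) * (y ^ 2 + y + 1) = 0 := by linear_combination hy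
  have h2 : y ^ 2 + y + 1 = 0 := (mul_eq_zero.1 h).resolve_left (sub_ne_zero.2 h1)
  have h3 : (y - 1) ^ 2 = -(3 * y) := by linear_combination h2
  rw [← map_pow, h3, Valuation.map_neg, map_mul, v.map_eq_one_of_pow_eq_one three_ne_zero hy,
    mul_one]

/-- All nontrivial cube roots of unity are equally close to 1. The resulting γ, a square root of `v
3`, is the unit in which Gauss sums are measured. -/
theorem Valuation.exists_sq_eq_three (v : Valuation C Γ) {ψ : AddChar F C} (hψ : ψ ≠ 1) :
    ∃ γ : Γ, γ ^ 2 = v 3 ∧ ∀ x, v (ψ x - 1) ≤ γ := by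
  obtain ⟨a, ha⟩ : ∃ a, ψ a ≠ 1 := by
    by_contra! h
    exact hψ (DFunLike.ext _ _ h)
  refine ⟨v (ψ a - 1), v.sub_one_sq_of_pow_three (ψ.pow_three_eq_one a) ha, fun x => ?_⟩
  rcases eq_or_ne (ψ x) 1 with h | h
  · simp [h]
  · refine le_of_eq ((pow_left_inj₀ zero_le zero_le two_ne_zero).1 ?_)
    rw [v.sub_one_sq_of_pow_three (ψ.pow_three_eq_one a) ha,
      v.sub_one_sq_of_pow_three (ψ.pow_three_eq_one x) h]

/-- A nontrivial χ sums to zero, so ψ may be replaced by ψ - 1. -/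
theorem Valuation.gaussSum_le (v : Valuation C Γ) {χ : MulChar F C} (hχ : χ ≠ 1)
    {ψ : AddChar F C} {γ : Γ} (hγ : ∀ x, v (ψ x - 1) ≤ γ) : v (gaussSum χ ψ) ≤ γ := by
  have h : gaussSum χ ψ = ∑ x, χ x * (ψ x - 1) := by
    simp only [mul_sub, mul_one, Finset.sum_sub_distrib, MulChar.sum_eq_zero_of_ne_one hχ, sub_zero]
    rfl
  rw [h]
  refine v.map_sum_le fun x _ => ?_
  rw [map_mul]
  exact (mul_le_mul' (v.mulChar_le_one χ x) (hγ x)).trans_eq (one_mul _)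

/-- The reduction of the Jacobi sum of the inverse Teichmüller character and its `j`-th power. -/
theorem sum_inv_pow_mul_inv_one_sub {j : ℕ} (hj : 0 < j) (hjq : j < Fintype.card F - 1) :
    ∑ x : F, x⁻¹ ^ j * (1 - x)⁻¹ = -((j : F) + 1) := by
  classical
  -- A finite geometric series in x⁻¹; the two indicator terms correct it at 0 and 1, where the
  -- convention `0⁻¹ = 0` intervenes.
  have key (x : F) : x⁻¹ ^ j * (1 - x)⁻¹ = (1 - x)⁻¹ + ∑ i ∈ Finset.range j, x⁻¹ ^ (i + 1)
      - (if x = 0 then 1 else 0) - (if x = 1 then (j : F) else 0) := by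
    by_cases h0 : x = 0
    · subst h0
      simp [hj.ne']
    by_cases h1 : x = 1
    · subst h1
      simp
    have h2 : 1 - x ≠ 0 := sub_ne_zero.2 (Ne.symm h1)
    have hg := geom_sum_mul x⁻¹ j
    have hx : x⁻¹ - 1 = x⁻¹ * (1 - x) := by field_simp
    simp only [h0, h1, if_false, sub_zero, pow_succ, ← Finset.sum_mul]
    rw [hx, ← mul_assoc] at hg
    rw [eq_sub_iff_add_eq] at hg
    rw [← hg, add_mul, mul_inv_cancel_right₀ h2, one_mul, add_comm]
  have hinv (n : ℕ) : ∑ x : F, x⁻¹ ^ n = ∑ x : F, x ^ n :=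
    Equiv.sum_comp (Equiv.inv F) fun x => x ^ n
  have hsum {n : ℕ} (hn : n < Fintype.card F - 1) : ∑ x : F, x ^ n = 0 :=
    FiniteField.sum_pow_lt_card_sub_one F n hn
  have h1 : ∑ x : F, (1 - x)⁻¹ = 0 := by
    refine ((Equiv.subLeft (1 : F)).sum_comp fun x => x⁻¹).trans ?_
    simpa using (hinv 1).trans (hsum (by omega))
  have h2 : ∑ x : F, ∑ i ∈ Finset.range j, x⁻¹ ^ (i + 1) = 0 := by
    rw [Finset.sum_comm]
    refine Finset.sum_eq_zero fun i hi => ?_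
    rw [hinv]
    exact hsum (by have := Finset.mem_range.1 hi; omega)
  simp only [key, Finset.sum_sub_distrib, Finset.sum_add_distrib, h1, h2]
  simp
  ring

end

section

variable {F C Γ : Type*} [Field F] [Fintype F] [CharP F 3] [Field C]
  [LinearOrderedCommGroupWithZero Γ] {v : Valuation C Γ} {φ : WittVector 3 F →+* C}

theorem eq_one_of_map_teichmuller_eq_one (hφ : ∀ w, v (φ w) ≤ 1) {a : F}
    (h : φ (WittVector.teichmuller 3 a) = 1) : a = 1 := by
  by_contra ha
  have h1 := v.map_eq_one_of_constantCoeff_ne_zero φ hφ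
    (w := WittVector.teichmuller 3 a - 1) (by
      rw [map_sub, map_one]
      simpa [WittVector.constantCoeff, sub_eq_zero] using ha)
  rw [map_sub, h, map_one, sub_self, map_zero] at h1
  exact zero_ne_one h1

theorem invTeichmuller_pow_ne_one (hφ : ∀ w, v (φ w) ≤ 1) {j : ℕ}
    (hj : ¬ Fintype.card F - 1 ∣ j) : invTeichmuller φ ^ j ≠ 1 := by
  intro h
  have hj0 : j ≠ 0 := fun h0 => hj (h0 ▸ dvd_zero _)
  refine hj ((FiniteField.forall_pow_eq_one_iff F j).1 fun x => ?_)
  have h1 : (invTeichmuller φ ^ j) ((x⁻¹ : Fˣ) : F) = 1 := by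
    rw [h, MulChar.one_apply (Units.isUnit _)]
  rw [invTeichmuller_pow_apply φ hj0] at h1
  have h2 := eq_one_of_map_teichmuller_eq_one hφ h1
  ext
  simpa using h2

theorem valuation_jacobiSum_invTeichmuller (hφ : ∀ w, v (φ w) ≤ 1) {j : ℕ} (hj : 0 < j)
    (hjq : j < Fintype.card F - 1) (h3 : ¬ 3 ∣ j + 1) :
    v (jacobiSum (invTeichmuller φ ^ j) (invTeichmuller φ)) = 1 := by
  have h : jacobiSum (invTeichmuller φ ^ j) (invTeichmuller φ) =
      φ (∑ x : F, WittVector.teichmuller 3 (x⁻¹ ^ j * (1 - x)⁻¹)) := by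
    rw [map_sum]
    refine Finset.sum_congr rfl fun x _ => ?_
    rw [invTeichmuller_pow_apply φ hj.ne', invTeichmuller_apply, map_mul, map_mul]
  rw [h]
  refine v.map_eq_one_of_constantCoeff_ne_zero φ hφ ?_
  have h2 : WittVector.constantCoeff
      (∑ x : F, WittVector.teichmuller 3 (x⁻¹ ^ j * (1 - x)⁻¹)) =
      ∑ x : F, x⁻¹ ^ j * (1 - x)⁻¹ := by
    rw [map_sum]
    rfl
  rw [h2, sum_inv_pow_mul_inv_one_sub hj hjq]
  intro h0
  refine h3 ((CharP.cast_eq_zero_iff F 3 (j + 1)).1 ?_)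
  push_cast
  exact neg_eq_zero.1 h0

theorem Nat.digits_three_sum_mul (n : ℕ) :
    (Nat.digits 3 (3 * n)).sum = (Nat.digits 3 n).sum := by
  rcases Nat.eq_zero_or_pos n with rfl | h
  · simp
  · rw [Nat.digits_base_mul (by norm_num) h]
    simp

theorem Nat.digits_three_sum_add (n : ℕ) {a : ℕ} (ha : a < 3) :
    (Nat.digits 3 (a + 3 * n)).sum = a + (Nat.digits 3 n).sum := by
  by_cases h : a ≠ 0 ∨ n ≠ 0
  · rw [Nat.digits_add 3 (by norm_num) a n ha h, List.sum_cons]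
  · push Not at h
    simp [h.1, h.2]

/-- The lower bound in Stickelberger's theorem for the valuations of Gauss sums. -/
theorem valuation_gaussSum_invTeichmuller_le (hφ : ∀ w, v (φ w) ≤ 1) {ψ : AddChar F C}
    (hψ : ∀ x, ψ (x ^ 3) = ψ x) {γ : Γ} (hγ : ∀ x, v (ψ x - 1) ≤ γ) {j : ℕ}
    (hj : j < Fintype.card F - 1) :
    v (gaussSum (invTeichmuller φ ^ j) ψ) ≤ γ ^ (Nat.digits 3 j).sum := by
  induction j using Nat.strong_induction_on with
  | _ j ih =>
    have hdiv := Nat.mod_add_div j 3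
    set a := j % 3 with ha
    set k := j / 3 with hk
    have ha3 : a < 3 := Nat.mod_lt _ (by norm_num)
    have hne {i : ℕ} (h0 : 0 < i) (hi : i < Fintype.card F - 1) : invTeichmuller φ ^ i ≠ 1 :=
      invTeichmuller_pow_ne_one hφ fun h => absurd (Nat.le_of_dvd h0 h) (by omega)
    rcases Nat.eq_zero_or_pos j with h0 | hpos
    · rw [h0]
      simpa using v.gaussSum_le_one _ ψ
    rcases Nat.eq_zero_or_pos a with h0 | hapos
    -- A final ternary digit 0 can be dropped: Frobenius leaves the Gauss sum unchanged.
    · rw [← hdiv, h0, zero_add, Nat.digits_three_sum_mul, mul_comm 3 k, pow_mul,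
        gaussSum_pow_three _ hψ]
      exact ih k (by omega) (by omega)
    · obtain ⟨i, rfl⟩ : ∃ i, j = i + 1 := ⟨j - 1, by omega⟩
      have hW : (Nat.digits 3 (i + 1)).sum = (Nat.digits 3 i).sum + 1 := by
        have e1 : i = (a - 1) + 3 * k := by omega
        rw [← hdiv, Nat.digits_three_sum_add k ha3]
        conv_rhs => rw [e1, Nat.digits_three_sum_add k (by omega)]
        omega
      rw [hW, pow_succ (γ)]
      rcases Nat.eq_zero_or_pos i with h0 | hipos
      · subst h0
        simpa using v.gaussSum_le (hne (i := 1) one_pos (by omega)) hγ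
      -- Lowering a nonzero final digit by one splits off a factor g(ω), up to a Jacobi sum. That
      -- sum reduces to -(i + 1) in F, nonzero here, so it is a unit.
      · have hJ := jacobiSum_mul_nontrivial (χ := invTeichmuller φ ^ i) (φ := invTeichmuller φ)
          (by rw [← pow_succ]; exact hne (Nat.succ_pos _) hj) ψ
        have hv := congrArg v hJ
        rw [map_mul, map_mul, valuation_jacobiSum_invTeichmuller hφ hipos (by omega) (by omega),
          mul_one, ← pow_succ] at hv
        rw [hv]
        refine mul_le_mul' (ih i (by omega) (by omega)) ?_
        refine v.gaussSum_le ?_ hγ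
        simpa using hne (i := 1) one_pos (by omega)

end

/-! ### Digit sums and products of two Gauss sums. -/

theorem Nat.digits_three_sum_add_nine (n : ℕ) {a : ℕ} (ha : a < 9) :
    (Nat.digits 3 (a + 9 * n)).sum = (Nat.digits 3 a).sum + (Nat.digits 3 n).sum := by
  have h1 : a + 9 * n = a % 3 + 3 * (a / 3 + 3 * n) := by omega
  have h2 : a = a % 3 + 3 * (a / 3 + 3 * 0) := by omega
  rw [h1, Nat.digits_three_sum_add _ (by omega), Nat.digits_three_sum_add _ (by omega)]
  conv_rhs => rw [h2, Nat.digits_three_sum_add _ (by omega), Nat.digits_three_sum_add _ (by omega)]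
  simp [add_assoc]

/-- One base-9 column of the addition below, with carry c in and c' out. Summed over the columns,
the carries telescope. -/
theorem Nat.digits_three_sum_block {u w c c' : ℕ} (hu : u < 9) (hw : w < 9) (hc : c < 2)
    (h : u + 2 + c = w + 9 * c') :
    2 + c' ≤ (Nat.digits 3 u).sum + (Nat.digits 3 w).sum + c := by
  have hd {n : ℕ} (hn : n < 9) : (Nat.digits 3 n).sum = n % 3 + n / 3 := by
    have h : n = n % 3 + 3 * (n / 3 + 3 * 0) := by omega
    conv_lhs => rw [h, Nat.digits_three_sum_add _ (by omega), Nat.digits_three_sum_add _ (by omega)]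
    simp
  rw [hd hu, hd hw]
  omega

/-- Adding `(9 ^ e - 1) / 4` with carries: the ternary digit sums of the summand and of the result
add up to at least `2 * e`. -/
theorem Nat.digits_three_sum_add_quarter (e : ℕ) : ∀ {a b c c' : ℕ}, a < 9 ^ e → b < 9 ^ e →
    c < 2 → c' < 2 → a + (9 ^ e - 1) / 4 + c = b + 9 ^ e * c' →
    2 * e + c' ≤ (Nat.digits 3 a).sum + (Nat.digits 3 b).sum + c := by
  induction e with
  | zero =>
    intro a b c c' ha hb hc hc' h
    simp at *
    omega
  | succ e ih =>
    intro a b c c' ha hb hc hc' h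
    have hq : 9 ^ (e + 1) = 9 * 9 ^ e := by ring
    -- Every base-9 digit of (9^e - 1) / 4 is 2.
    have hd : (9 ^ (e + 1) - 1) / 4 = 2 + 9 * ((9 ^ e - 1) / 4) := by
      have : 9 ^ e % 4 = 1 := by norm_num [Nat.pow_mod]
      omega
    set Q := 9 ^ e
    set D := (Q - 1) / 4
    rw [hd, hq] at h
    rw [hq] at ha hb
    have ea : a = a % 9 + 9 * (a / 9) := (Nat.mod_add_div a 9).symm
    have eb : b = b % 9 + 9 * (b / 9) := (Nat.mod_add_div b 9).symm
    set c1 := (a % 9 + 2 + c) / 9 with hc1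
    have hblock := Nat.digits_three_sum_block (u := a % 9) (w := b % 9) (c := c) (c' := c1)
      (by omega) (by omega) hc (by
        have : 9 * Q * c' = 9 * (Q * c') := by ring
        omega)
    have hrec := ih (a := a / 9) (b := b / 9) (c := c1) (c' := c') (by omega) (by omega)
      (by omega) hc' (by
        have : 9 * Q * c' = 9 * (Q * c') := by ring
        omega)
    rw [ea, eb, Nat.digits_three_sum_add_nine _ (by omega),
      Nat.digits_three_sum_add_nine _ (by omega)]
    omega

section

variable {F C Γ : Type*} [Field F] [Fintype F] [CharP F 3] [Field C]
  [LinearOrderedCommGroupWithZero Γ] {v : Valuation C Γ} {φ : WittVector 3 F →+* C}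

theorem MulChar.pow_card_sub_one_eq_one (χ : MulChar F C) : χ ^ (Fintype.card F - 1) = 1 := by
  classical
  rw [← Fintype.card_units]
  exact χ.pow_card_eq_one

theorem MulChar.pow_mod_card_sub_one (χ : MulChar F C) (j : ℕ) :
    χ ^ (j % (Fintype.card F - 1)) = χ ^ j := by
  conv_rhs => rw [← Nat.mod_add_div j (Fintype.card F - 1), pow_add, pow_mul,
    χ.pow_card_sub_one_eq_one, one_pow, mul_one]

theorem valuation_gaussSum_mul_gaussSum_le (hφ : ∀ w, v (φ w) ≤ 1) (h3 : v 3 < 1)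
    {ψ : AddChar F C} (hψ1 : ψ ≠ 1) (hψ : ∀ x, ψ (x ^ 3) = ψ x) {e : ℕ} (he : 0 < e)
    (hF : Fintype.card F = 9 ^ e) (j : ℕ) :
    v (gaussSum (invTeichmuller φ ^ j) ψ * gaussSum (invTeichmuller φ ^ (j + (9 ^ e - 1) / 4)) ψ)
      ≤ v 3 ^ e := by
  obtain ⟨γ, hγ2, hγ⟩ := v.exists_sq_eq_three hψ1
  have hγ1 : γ ≤ 1 := by
    by_contra h
    push Not at h
    have : 1 < γ ^ 2 := one_lt_pow₀ h two_ne_zero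
    rw [hγ2] at this
    exact absurd this (not_lt.2 h3.le)
  have hq1 : 9 ≤ 9 ^ e := Nat.le_self_pow he.ne' 9
  rw [← MulChar.pow_mod_card_sub_one _ j, ← MulChar.pow_mod_card_sub_one _ (j + _), hF]
  set d := (9 ^ e - 1) / 4 with hd
  set q := 9 ^ e with hq
  have ha : j % (q - 1) < q - 1 := Nat.mod_lt _ (by omega)
  have hb : (j + d) % (q - 1) < q - 1 := Nat.mod_lt _ (by omega)
  have hab : (j + d) % (q - 1) = (j % (q - 1) + d) % (q - 1) := by simp
  set a := j % (q - 1)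
  set b := (j + d) % (q - 1)
  have hdig : 2 * e ≤ (Nat.digits 3 a).sum + (Nat.digits 3 b).sum := by
    rcases lt_or_ge (a + d) (q - 1) with h | h
    · rw [Nat.mod_eq_of_lt h] at hab
      have := Nat.digits_three_sum_add_quarter e (a := a) (b := b) (c := 0) (c' := 0)
        (by omega) (by omega) (by norm_num) (by norm_num) (by omega)
      omega
    -- Reduction modulo q - 1 is an end-around carry: a + d = b + (q - 1) reads a + d + 1 = b + q,
    -- so the carries in and out are both 1 and cancel.
    · rw [Nat.mod_eq_sub_mod h, Nat.mod_eq_of_lt (by omega)] at hab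
      have := Nat.digits_three_sum_add_quarter e (a := a) (b := b) (c := 1) (c' := 1)
        (by omega) (by omega) (by norm_num) (by norm_num) (by omega)
      omega
  rw [map_mul]
  calc _ ≤ γ ^ (Nat.digits 3 a).sum * γ ^ (Nat.digits 3 b).sum :=
        mul_le_mul' (valuation_gaussSum_invTeichmuller_le hφ hψ hγ (by omega))
          (valuation_gaussSum_invTeichmuller_le hφ hψ hγ (by omega))
    _ = γ ^ ((Nat.digits 3 a).sum + (Nat.digits 3 b).sum) := (pow_add _ _ _).symm
    _ ≤ γ ^ (2 * e) := pow_le_pow_right_of_le_one' hγ1 hdig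
    _ = v 3 ^ e := by rw [pow_mul, hγ2]

/-! ### Fourier expansion on the multiplicative group and Kloosterman sums. -/

theorem sum_invTeichmuller_pow_apply (hφ : ∀ w, v (φ w) ≤ 1) {z : F} (hz : z ≠ 0) (hz1 : z ≠ 1) :
    ∑ j ∈ Finset.range (Fintype.card F - 1), (invTeichmuller φ ^ j) z = 0 := by
  have h1 : invTeichmuller φ z ≠ 1 := by
    intro h
    rw [invTeichmuller_apply] at h
    exact hz1 (inv_eq_one.1 (eq_one_of_map_teichmuller_eq_one hφ h))
  have h2 (j : ℕ) : (invTeichmuller φ ^ j) z = invTeichmuller φ z ^ j :=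
    MulChar.pow_apply_coe _ j (Units.mk0 z hz)
  have h3 := mul_geom_sum (invTeichmuller φ z) (Fintype.card F - 1)
  rw [← h2 (Fintype.card F - 1), MulChar.pow_card_sub_one_eq_one,
    MulChar.one_apply (isUnit_iff_ne_zero.2 hz), sub_self] at h3
  simp only [h2]
  exact (mul_eq_zero.1 h3).resolve_left (sub_ne_zero.2 h1)

theorem card_sub_one_mul_addChar_apply (hφ : ∀ w, v (φ w) ≤ 1) (ψ : AddChar F C) {x : F}
    (hx : x ≠ 0) : ((Fintype.card F - 1 : ℕ) : C) * ψ x =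
      ∑ j ∈ Finset.range (Fintype.card F - 1),
        (invTeichmuller φ ^ j) x⁻¹ * gaussSum (invTeichmuller φ ^ j) ψ := by
  classical
  have h (y : F) : ∑ j ∈ Finset.range (Fintype.card F - 1),
      (invTeichmuller φ ^ j) x⁻¹ * ((invTeichmuller φ ^ j) y * ψ y) =
      if y = x then ((Fintype.card F - 1 : ℕ) : C) * ψ x else 0 := by
    simp only [← mul_assoc, ← map_mul, ← Finset.sum_mul]
    split_ifs with hy
    · subst hy
      simp [inv_mul_cancel₀ hx]
    · by_cases hy0 : y = 0
      · subst hy0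
        simp [MulChar.map_zero]
      · rw [sum_invTeichmuller_pow_apply hφ (mul_ne_zero (inv_ne_zero hx) hy0), zero_mul]
        intro h
        exact hy (by field_simp at h; exact h)
  simp only [gaussSum, Finset.mul_sum]
  rw [Finset.sum_comm]
  simp [h]

theorem Valuation.natCast_le_one_of_wittVector (hφ : ∀ w, v (φ w) ≤ 1) (n : ℕ) :
    v (n : C) ≤ 1 := by
  simpa using hφ n

/-- For a ≠ 0 the shift only costs a root of unity. For a = 0 the sum vanishes unless χ = 1; then it
is the integer q - 1, while the Gauss sum is -1. -/
theorem valuation_mul_sum_mulChar_mul_addChar_le (hφ : ∀ w, v (φ w) ≤ 1) {ψ : AddChar F C}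
    (hψ1 : ψ ≠ 1) {g : C} {B : Γ} {χ : MulChar F C} (h : v (g * gaussSum χ ψ) ≤ B) (a : F) :
    v (g * ∑ x, χ x * ψ (a * x)) ≤ B := by
  classical
  by_cases ha : a = 0
  · by_cases hχ : χ = 1
    · subst hχ
      rw [gaussSum_one_left hψ1, mul_neg, mul_one, Valuation.map_neg] at h
      have : ∑ x : F, (1 : MulChar F C) x * ψ (a * x) = (Fintype.card Fˣ : C) := by
        simp [ha, MulChar.sum_one_eq_card_units]
      rw [this, map_mul]
      exact (mul_le_mul' h (Valuation.natCast_le_one_of_wittVector hφ _)).trans_eq (mul_one _)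
    · simp [ha, MulChar.sum_eq_zero_of_ne_one hχ]
  · have h1 := gaussSum_mulShift χ ψ (Units.mk0 a ha)
    have h2 : ∑ x, χ x * ψ (a * x) = gaussSum χ (ψ.mulShift a) := rfl
    have h3 : v (χ a) = 1 := by
      refine v.map_eq_one_of_pow_eq_one (n := Fintype.card F - 1) ?_ ?_
      · have := Fintype.one_lt_card (α := F)
        omega
      · rw [← map_pow, FiniteField.pow_card_sub_one_eq_one a ha, map_one]
    have h4 := congrArg v h1
    rw [map_mul, Units.val_mk0, h3, one_mul] at h4
    rwa [h2, map_mul, h4, ← map_mul]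

/-- Divisibility of twisted Kloosterman sums. -/
theorem valuation_twisted_kloosterman_le (hφ : ∀ w, v (φ w) ≤ 1) {ψ : AddChar F C}
    (hψ1 : ψ ≠ 1) {B : Γ} {η : MulChar F C}
    (h : ∀ j, v (gaussSum (invTeichmuller φ ^ j) ψ * gaussSum (invTeichmuller φ ^ j * η) ψ) ≤ B)
    (a : F) {b : F} (hb : b ≠ 0) :
    v (∑ x, η x * ψ (a * x + b * x⁻¹)) ≤ B := by
  have hq : v ((Fintype.card F - 1 : ℕ) : C) = 1 := by
    refine v.natCast_eq_one_of_not_dvd φ hφ fun hd => ?_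
    have h3 : 3 ∣ Fintype.card F := by
      obtain ⟨n, hp, hn⟩ := FiniteField.card F 3
      rw [hn]
      exact dvd_pow_self 3 n.ne_zero
    have := Fintype.one_lt_card (α := F)
    omega
  -- Expand ψ(b/x) in multiplicative characters and exchange the sums; the factor q - 1 is a 3-adic
  -- unit.
  have key : ((Fintype.card F - 1 : ℕ) : C) * ∑ x, η x * ψ (a * x + b * x⁻¹) =
      ∑ j ∈ Finset.range (Fintype.card F - 1), (invTeichmuller φ ^ j) b⁻¹ *
        (gaussSum (invTeichmuller φ ^ j) ψ *
          ∑ x, (invTeichmuller φ ^ j * η) x * ψ (a * x)) := by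
    simp only [Finset.mul_sum]
    rw [Finset.sum_comm]
    refine Finset.sum_congr rfl fun x _ => ?_
    by_cases hx : x = 0
    · simp [hx, MulChar.map_zero]
    · have h1 := card_sub_one_mul_addChar_apply hφ ψ (mul_ne_zero hb (inv_ne_zero hx))
      rw [AddChar.map_add_eq_mul, mul_left_comm, mul_left_comm (Nat.cast _), h1, Finset.mul_sum,
        Finset.mul_sum]
      refine Finset.sum_congr rfl fun j _ => ?_
      rw [mul_inv, inv_inv, map_mul (invTeichmuller φ ^ j), MulChar.mul_apply]
      ring
  have hv := congrArg v key
  rw [map_mul, hq, one_mul] at hv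
  rw [hv]
  refine v.map_sum_le fun j _ => ?_
  rw [map_mul]
  exact (mul_le_mul' (v.mulChar_le_one _ _)
    (valuation_mul_sum_mulChar_mul_addChar_le hφ hψ1 (h j) a)).trans_eq (one_mul _)

end

/-! ### Quartic character sums over cubic polynomials. -/

section

variable {F C Γ : Type*} [Field F] [Fintype F] [CharP F 3] [Field C] [CharZero C]
  [LinearOrderedCommGroupWithZero Γ] {v : Valuation C Γ}

theorem sum_addChar_mul {ψ : AddChar F C} (hψ : ψ ≠ 1) [DecidableEq F] (b : F) :
    ∑ t, ψ (b * t) = if b = 0 then (Fintype.card F : C) else 0 := by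
  have := AddChar.sum_mulShift b (AddChar.IsPrimitive.of_ne_one hψ)
  simpa [mul_comm] using this

theorem mulChar_apply_mul_gaussSum {χ : MulChar F C} (hχ : χ ≠ 1) (ψ : AddChar F C) (y : F) :
    χ y * gaussSum χ⁻¹ ψ = ∑ x, χ⁻¹ x * ψ (x * y) := by
  by_cases hy : y = 0
  · have : χ⁻¹ ≠ 1 := inv_ne_one.2 hχ
    simp [hy, MulChar.map_zero, MulChar.sum_eq_zero_of_ne_one this]
  · have h := gaussSum_mulShift_eq χ⁻¹ ψ (Units.mk0 y hy)
    rw [inv_inv] at h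
    rw [Units.val_mk0] at h
    rw [← h]
    simp [gaussSum, AddChar.mulShift_apply, mul_comm]

/-- A character whose square is not trivial but whose fourth power is squares to the quadratic
character. -/
theorem MulChar.sq_eq_quadraticChar {χ : MulChar F C} [DecidableEq F] (h4 : χ ^ 4 = 1)
    (h2 : χ ^ 2 ≠ 1) : χ ^ 2 = (quadraticChar F).ringHomComp (Int.castRingHom C) := by
  have hsq {a : F} (ha : a ≠ 0) (hs : IsSquare a) : (χ ^ 2) a = 1 := by
    obtain ⟨b, rfl⟩ := hs
    have hb : IsUnit b := isUnit_iff_ne_zero.2 (by rintro rfl; simp at ha)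
    rw [map_mul, ← MulChar.mul_apply, ← pow_add, h4, MulChar.one_apply hb]
  obtain ⟨c, hc⟩ := MulChar.ne_one_iff.1 h2
  have hcns : ¬ IsSquare (c : F) := fun h => hc (hsq c.ne_zero h)
  have hc1 : (χ ^ 2) (c : F) = -1 := by
    have : (χ ^ 2) (c : F) ^ 2 = 1 := by
      rw [sq, ← MulChar.mul_apply, ← pow_add, h4, MulChar.one_apply c.isUnit]
    exact (sq_eq_one_iff.1 this).resolve_left hc
  have hF : ringChar F ≠ 2 := by
    rw [ringChar.eq F 3]
    norm_num
  ext a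
  by_cases hs : IsSquare (a : F)
  · rw [hsq a.ne_zero hs, MulChar.ringHomComp_apply,
      (quadraticChar_one_iff_isSquare a.ne_zero).2 hs]
    simp
  · have hq1 := (quadraticChar_neg_one_iff_not_isSquare (a := (a : F))).2 hs
    have hq2 := (quadraticChar_neg_one_iff_not_isSquare (a := (c : F))).2 hcns
    have hac : IsSquare ((a : F) * c) := by
      rw [← quadraticChar_one_iff_isSquare (mul_ne_zero a.ne_zero c.ne_zero), map_mul, hq1, hq2]
      norm_num
    have := hsq (mul_ne_zero a.ne_zero c.ne_zero) hac
    rw [map_mul, hc1] at this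
    rw [MulChar.ringHomComp_apply, hq1]
    simp
    linear_combination -this

theorem sum_addChar_mul_sq {χ : MulChar F C} (h4 : χ ^ 4 = 1) (h2 : χ ^ 2 ≠ 1)
    {ψ : AddChar F C} (hψ : ψ ≠ 1) {a : F} (ha : a ≠ 0) :
    ∑ t, ψ (a * t ^ 2) = (χ ^ 2) a * gaussSum (χ ^ 2) ψ := by
  classical
  have hF : ringChar F ≠ 2 := by
    rw [ringChar.eq F 3]
    norm_num
  have h1 : ∑ t, ψ (a * t ^ 2) = ∑ x, (((quadraticChar F x : ℤ) : C) + 1) * ψ (a * x) := by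
    rw [← Finset.sum_fiberwise (s := Finset.univ) (g := fun t : F => t ^ 2)]
    refine Finset.sum_congr rfl fun x _ => ?_
    have hcard := quadraticChar_card_sqrts hF x
    have : ∀ t ∈ Finset.univ.filter (fun t : F => t ^ 2 = x), ψ (a * t ^ 2) = ψ (a * x) := by
      intro t ht
      rw [(Finset.mem_filter.1 ht).2]
    rw [Finset.sum_congr rfl this, Finset.sum_const, nsmul_eq_mul]
    congr 1
    have h2 : {t : F | t ^ 2 = x}.toFinset = Finset.univ.filter (fun t : F => t ^ 2 = x) := by
      ext; simp
    rw [h2] at hcard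
    exact_mod_cast hcard
  have hinv : (χ ^ 2)⁻¹ = χ ^ 2 := inv_eq_of_mul_eq_one_left (by rw [← pow_add, h4])
  have h3 := mulChar_apply_mul_gaussSum h2 ψ a
  rw [hinv] at h3
  rw [h1, h3]
  simp only [add_mul, one_mul, Finset.sum_add_distrib, sum_addChar_mul hψ, if_neg ha, add_zero]
  refine Finset.sum_congr rfl fun x _ => ?_
  rw [MulChar.sq_eq_quadraticChar h4 h2, MulChar.ringHomComp_apply, mul_comm x]
  rfl

/-- Completing the square in characteristic 3, where 4 = 1 and -1/2 = 1. -/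
theorem sum_addChar_quadratic {χ : MulChar F C} (h4 : χ ^ 4 = 1) (h2 : χ ^ 2 ≠ 1)
    {ψ : AddChar F C} (hψ : ψ ≠ 1) {a : F} (ha : a ≠ 0) (b c : F) :
    ∑ t, ψ (a * t ^ 2 + b * t + c) =
      ψ (c - b ^ 2 / a) * ((χ ^ 2) a * gaussSum (χ ^ 2) ψ) := by
  rw [← sum_addChar_mul_sq h4 h2 hψ ha, Finset.mul_sum,
    ← Equiv.sum_comp (Equiv.addRight (b / a)) fun t => ψ (a * t ^ 2 + b * t + c)]
  refine Finset.sum_congr rfl fun t _ => ?_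
  rw [← AddChar.map_add_eq_mul]
  congr 1
  have h3 : (3 : F) = 0 := CharP.cast_eq_zero F 3
  simp only [Equiv.coe_addRight]
  field_simp
  linear_combination (a * b * t + b ^ 2) * h3

/-- In g(χ, ψ) g(χ⁻¹, ψ⁻¹) = q the second factor equals g(χ⁻¹, ψ) up to a sign. -/
theorem valuation_gaussSum_sq_eq {χ : MulChar F C} (hχ : χ ≠ 1) {ψ : AddChar F C} (hψ : ψ ≠ 1)
    (h : gaussSum χ⁻¹ ψ = gaussSum χ ψ) : v (gaussSum χ ψ) ^ 2 = v (Fintype.card F : C) := by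
  have h1 := gaussSum_mul_gaussSum_eq_card hχ (AddChar.IsPrimitive.of_ne_one hψ)
  have h2 := mul_gaussSum_inv_eq_gaussSum χ⁻¹ ψ
  have h3 : v (χ⁻¹ (-1)) = 1 := by
    refine v.map_eq_one_of_pow_eq_one two_ne_zero ?_
    rw [← map_pow, neg_one_sq, map_one]
  have h4 : v (gaussSum χ⁻¹ ψ⁻¹) = v (gaussSum χ ψ) := by
    rw [← h, ← h2, map_mul, h3, one_mul]
  rw [← h1, map_mul, h4, sq]

end

section

variable {F C Γ : Type*} [Field F] [Fintype F] [CharP F 3] [Field C] [CharZero C]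
  [LinearOrderedCommGroupWithZero Γ] {v : Valuation C Γ}

theorem mulChar_cube_eq_inv {χ : MulChar F C} (h4 : χ ^ 4 = 1) : χ ^ 3 = χ⁻¹ :=
  eq_inv_of_mul_eq_one_left (by rw [← pow_succ, h4])

/-- The sum of a quartic character over the values of a cubic polynomial, times a Gauss sum, as a
sum of quadratic exponential sums. -/
theorem sum_mulChar_cubic_mul_gaussSum {χ : MulChar F C} (hχ : χ ≠ 1) (h4 : χ ^ 4 = 1)
    {ψ : AddChar F C} (hψ3 : ∀ x, ψ (x ^ 3) = ψ x) {a : F} (ha : a ≠ 0) (b c d : F) :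
    (∑ t, χ (a * t ^ 3 + b * t ^ 2 + c * t + d)) * gaussSum χ⁻¹ ψ =
      ∑ x, χ x * χ a * ∑ t, ψ (x ^ 3 * b / a * t ^ 2 + (x + x ^ 3 * c / a) * t + x ^ 3 * d / a) := by
  rw [Finset.sum_mul]
  simp only [mulChar_apply_mul_gaussSum hχ ψ]
  rw [Finset.sum_comm]
  -- Substituting x³/a for the Gauss sum variable makes the leading term (xt)³, which ψ does not
  -- distinguish from xt.
  have hb : Function.Bijective fun x : F => x ^ 3 * a⁻¹ :=
    (mulRight_bijective₀ a⁻¹ (inv_ne_zero ha)).comp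
      (PerfectRing.bijective_frobenius (R := F) (p := 3))
  rw [← hb.sum_comp]
  refine Finset.sum_congr rfl fun x _ => ?_
  have h1 : χ⁻¹ (x ^ 3 * a⁻¹) = χ x * χ a := by
    rw [map_mul, map_pow, ← MulChar.pow_apply' _ three_ne_zero, MulChar.inv_apply' χ a⁻¹, inv_inv,
      inv_pow, mulChar_cube_eq_inv h4, inv_inv]
  rw [Finset.mul_sum]
  refine Finset.sum_congr rfl fun t _ => ?_
  rw [h1]
  congr 1
  have h2 : x ^ 3 * a⁻¹ * (a * t ^ 3 + b * t ^ 2 + c * t + d) =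
      (x * t) ^ 3 + (x ^ 3 * b / a * t ^ 2 + x ^ 3 * c / a * t + x ^ 3 * d / a) := by
    field_simp
    ring
  rw [h2, AddChar.map_add_eq_mul, hψ3, ← AddChar.map_add_eq_mul]
  congr 1
  ring

/-- Divisibility of the sum of a quartic character over the values of a cubic polynomial. -/
theorem valuation_sum_mulChar_cubic_le {χ : MulChar F C} (h4 : χ ^ 4 = 1) (h2 : χ ^ 2 ≠ 1)
    {ψ : AddChar F C} (hψ1 : ψ ≠ 1) (hψ3 : ∀ x, ψ (x ^ 3) = ψ x) {B : Γ} (hB : B ≠ 0)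
    (hq : v (Fintype.card F : C) = B ^ 2)
    (hK : ∀ a b : F, b ≠ 0 → v (∑ x, χ⁻¹ x * ψ (a * x + b * x⁻¹)) ≤ B)
    {a : F} (ha : a ≠ 0) (b c d : F) :
    v (∑ t, χ (a * t ^ 3 + b * t ^ 2 + c * t + d)) ≤ B := by
  classical
  have hχ : χ ≠ 1 := by
    rintro rfl
    simp at h2
  have hG : gaussSum χ⁻¹ ψ = gaussSum χ ψ := by
    rw [← mulChar_cube_eq_inv h4, gaussSum_pow_three χ hψ3]
  have hvG : v (gaussSum χ⁻¹ ψ) = B := by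
    rw [hG]
    refine (pow_left_inj₀ zero_le zero_le two_ne_zero).1 ?_
    rw [valuation_gaussSum_sq_eq hχ hψ1 hG, hq]
  have hinv : (χ ^ 2)⁻¹ = χ ^ 2 := inv_eq_of_mul_eq_one_left (by rw [← pow_add, h4])
  have hvG2 : v (gaussSum (χ ^ 2) ψ) = B := by
    refine (pow_left_inj₀ zero_le zero_le two_ne_zero).1 ?_
    rw [valuation_gaussSum_sq_eq h2 hψ1 (by rw [hinv]), hq]
  -- The Gauss sum has valuation exactly `B`, so a bound of `B * B` for the product suffices.
  refine le_of_mul_le_mul_right (a := B) ?_ (zero_lt_iff.2 hB)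
  conv_lhs => rw [← hvG, ← map_mul, sum_mulChar_cubic_mul_gaussSum hχ h4 hψ3 ha]
  by_cases hb : b = 0
  · refine v.map_sum_le fun x _ => ?_
    have hin : v (∑ t, ψ (x ^ 3 * b / a * t ^ 2 + (x + x ^ 3 * c / a) * t + x ^ 3 * d / a)) ≤
        B * B := by
      simp only [hb, mul_zero, zero_div, zero_mul, zero_add, AddChar.map_add_eq_mul _ _ (_ / a),
        ← Finset.sum_mul, sum_addChar_mul hψ1]
      rw [map_mul, v.addChar_eq_one, mul_one]
      split_ifs
      · rw [hq, sq]
      · simp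
    rw [map_mul, map_mul]
    calc _ ≤ 1 * 1 * (B * B) :=
          mul_le_mul' (mul_le_mul' (v.mulChar_le_one _ _) (v.mulChar_le_one _ _)) hin
      _ = B * B := by simp
  -- The square completes to an exponent whose x³ coefficient is d/a - c²/(ab). With k its cube
  -- root, (kx)³ becomes kx under ψ and a Kloosterman sum remains.
  · obtain ⟨k, hk⟩ := (PerfectRing.bijective_frobenius (R := F) (p := 3)).2
      (d / a - c ^ 2 / (a * b))
    beta_reduce at hk
    have key (x : F) : χ x * χ a *
        ∑ t, ψ (x ^ 3 * b / a * t ^ 2 + (x + x ^ 3 * c / a) * t + x ^ 3 * d / a) =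
        χ a * (χ ^ 2) (b / a) * gaussSum (χ ^ 2) ψ *
          (χ⁻¹ x * ψ ((k - 2 * c / b) * x + -(a / b) * x⁻¹)) := by
      by_cases hx : x = 0
      · simp [hx, MulChar.map_zero]
      have hA : x ^ 3 * b / a ≠ 0 := div_ne_zero (mul_ne_zero (pow_ne_zero _ hx) hb) ha
      rw [sum_addChar_quadratic h4 h2 hψ1 hA]
      have e1 : x ^ 3 * d / a - (x + x ^ 3 * c / a) ^ 2 / (x ^ 3 * b / a) =
          (k * x) ^ 3 + (-(2 * c / b) * x + -(a / b) * x⁻¹) := by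
        rw [mul_pow, hk]
        field_simp
        ring
      have e2 : χ x * (χ ^ 2) (x ^ 3 * b / a) = χ⁻¹ x * (χ ^ 2) (b / a) := by
        rw [mul_div_assoc, map_mul, ← mul_assoc]
        congr 1
        rw [map_pow, ← MulChar.pow_apply' _ three_ne_zero, ← MulChar.mul_apply, ← pow_mul,
          ← pow_succ', ← mulChar_cube_eq_inv h4]
        rw [show 2 * 3 + 1 = 4 + 3 from rfl, pow_add, h4, one_mul]
      rw [e1, AddChar.map_add_eq_mul, hψ3, ← AddChar.map_add_eq_mul]
      have e3 : k * x + (-(2 * c / b) * x + -(a / b) * x⁻¹) =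
          (k - 2 * c / b) * x + -(a / b) * x⁻¹ := by ring
      rw [e3]
      linear_combination (χ a * ψ ((k - 2 * c / b) * x + -(a / b) * x⁻¹) *
        gaussSum (χ ^ 2) ψ) * e2
    simp only [key, ← Finset.mul_sum]
    rw [map_mul, map_mul, map_mul, hvG2]
    calc _ ≤ 1 * 1 * B * B :=
          mul_le_mul' (mul_le_mul' (mul_le_mul' (v.mulChar_le_one _ _) (v.mulChar_le_one _ _))
            le_rfl) (hK _ _ (neg_ne_zero.2 (div_ne_zero ha hb)))
      _ = B * B := by simp

end

/-! ### The norm form and its sum over the trace-one hyperplane. -/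

theorem FiniteField.trace_pow_char (K L : Type*) [Field K] [Field L] [Finite L] [Algebra K L]
    (p : ℕ) [Fact p.Prime] [CharP L p] (x : L) :
    Algebra.trace K L (x ^ p) = Algebra.trace K L x ^ p := by
  refine (algebraMap K L).injective ?_
  rw [map_pow (algebraMap K L), FiniteField.algebraMap_trace_eq_sum_pow, FiniteField.algebraMap_trace_eq_sum_pow,
    sum_pow_char]
  exact Finset.sum_congr rfl fun i _ => by rw [← pow_mul, ← pow_mul, mul_comm]

theorem exists_addChar_pow_three (F C : Type*) [Field F] [Finite F] [CharP F 3] [Field C]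
    [CharZero C] [IsAlgClosed C] : ∃ ψ : AddChar F C, ψ ≠ 1 ∧ ∀ x, ψ (x ^ 3) = ψ x := by
  let := ZMod.algebra F 3
  obtain ⟨ζ, hζ⟩ := HasEnoughRootsOfUnity.exists_primitiveRoot C 3
  let ψ := (AddChar.zmodChar 3 hζ.pow_eq_one).compAddMonoidHom
    (Algebra.trace (ZMod 3) F).toAddMonoidHom
  have hψ (x : F) : ψ x = AddChar.zmodChar 3 hζ.pow_eq_one (Algebra.trace (ZMod 3) F x) := rfl
  refine ⟨ψ, ?_, fun x => ?_⟩
  · intro h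
    obtain ⟨x, hx⟩ := Algebra.trace_surjective (ZMod 3) F 1
    have h1 : ψ x = 1 := by rw [h, AddChar.one_apply]
    rw [hψ, hx, AddChar.zmodChar_apply] at h1
    exact hζ.ne_one (by norm_num) (by simpa [ZMod.val_one] using h1)
  · rw [hψ, hψ, FiniteField.trace_pow_char, ZMod.pow_card]

/-- The norm along a line in a cubic extension is a cubic polynomial. -/
theorem exists_norm_add_smul_eq {K L : Type*} [Field K] [Field L] [Algebra K L]
    (h : Module.finrank K L = 3) (u : L) {w : L} (hw : w ≠ 0) :
    ∃ b c d : K, ∀ t : K, Algebra.norm K (u + t • w) =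
      Algebra.norm K w * t ^ 3 + b * t ^ 2 + c * t + d := by
  have : Module.Finite K L := Module.finite_of_finrank_pos (by omega)
  set P := (LinearMap.mulLeft K (-(u / w))).charpoly with hP
  have hdeg : P.natDegree = 3 := by rw [hP, LinearMap.charpoly_natDegree, h]
  have hmon : P.Monic := LinearMap.charpoly_monic _
  have hPe (t : K) : P.eval t = t ^ 3 + P.coeff 2 * t ^ 2 + P.coeff 1 * t + P.coeff 0 := by
    rw [Polynomial.eval_eq_sum_range, hdeg]
    have : P.coeff 3 = 1 := by rw [← hdeg]; exact hmon
    simp [Finset.sum_range_succ, this]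
    ring
  refine ⟨Algebra.norm K w * P.coeff 2, Algebra.norm K w * P.coeff 1,
    Algebra.norm K w * P.coeff 0, fun t => ?_⟩
  -- N(u + tw) is N(w) times the characteristic polynomial of -u/w evaluated at t.
  have h1 : u + t • w = w * (algebraMap K L t - (-(u / w))) := by
    rw [Algebra.smul_def]
    field_simp
    ring
  have h2 : Algebra.norm K (algebraMap K L t - (-(u / w))) = P.eval t := by
    rw [hP, LinearMap.eval_charpoly, Algebra.norm_apply]
    congr 1
    ext x
    simp [Algebra.algebraMap_eq_smul_one]
  rw [h1, map_mul, h2, hPe]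
  ring

section

variable {F L C : Type*} [Field F] [Fintype F] [CharP F 3] [Field C] [CharZero C]
  [Field L] [Fintype L] [Algebra F L]

/-- The composition of a multiplicative character with the norm of an extension. -/
noncomputable def MulChar.compNorm (L : Type*) [Field L] [Algebra F L] [FiniteDimensional F L]
    (χ : MulChar F C) : MulChar L C where
  toFun x := χ (Algebra.norm F x)
  map_one' := by simp
  map_mul' x y := by simp
  map_nonunit' x hx := by
    obtain rfl : x = 0 := by simpa using hx
    rw [Algebra.norm_zero, MulChar.map_zero]

theorem MulChar.compNorm_apply [FiniteDimensional F L] (χ : MulChar F C) (x : L) :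
    χ.compNorm L x = χ (Algebra.norm F x) := rfl

theorem MulChar.compNorm_inv [FiniteDimensional F L] (χ : MulChar F C) :
    (χ.compNorm L)⁻¹ = χ⁻¹.compNorm L := by
  refine inv_eq_of_mul_eq_one_left ?_
  ext x
  rw [MulChar.mul_apply, MulChar.compNorm_apply, MulChar.compNorm_apply, ← MulChar.mul_apply,
    inv_mul_cancel, MulChar.one_apply_coe, MulChar.one_apply (x.isUnit.map (Algebra.norm F))]

/-- The Gauss sum of a lifted character in terms of the sum over an affine hyperplane. -/
theorem gaussSum_compNorm [FiniteDimensional F L] [DecidableEq F]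
    (hL : Module.finrank F L = 3) {χ : MulChar F C} (hχ : χ ^ 3 ≠ 1) (ψ : AddChar F C) :
    gaussSum (χ.compNorm L) (ψ.compAddMonoidHom (Algebra.trace F L).toAddMonoidHom) =
      (∑ y : L with Algebra.trace F L y = 1, χ (Algebra.norm F y)) * gaussSum (χ ^ 3) ψ := by
  set f : F → C := fun c => ∑ y : L with Algebra.trace F L y = c, χ (Algebra.norm F y) with hf
  -- Scaling y by a multiplies the trace by a and the norm by a³, so all fibre sums follow from the
  -- one over trace 1.
  have hscale (c : F) {a : F} (ha : a ≠ 0) : f (a * c) = (χ ^ 3) a * f c := by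
    simp only [hf, Finset.mul_sum]
    refine Finset.sum_nbij' (fun y => a⁻¹ • y) (fun y => a • y) ?_ ?_ ?_ ?_ ?_
    · intro y hy
      simp only [Finset.mem_filter, Finset.mem_univ, true_and] at hy ⊢
      rw [map_smul, hy, smul_eq_mul, inv_mul_cancel_left₀ ha]
    · intro y hy
      simp only [Finset.mem_filter, Finset.mem_univ, true_and] at hy ⊢
      rw [map_smul, hy, smul_eq_mul]
    · intro y _
      exact smul_inv_smul₀ ha y
    · intro y _
      exact inv_smul_smul₀ ha y
    · intro y _
      have : Algebra.norm F y = a ^ 3 * Algebra.norm F (a⁻¹ • y) := by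
        conv_lhs => rw [← smul_inv_smul₀ ha y, Algebra.smul_def, map_mul, Algebra.norm_algebraMap,
          hL]
      rw [this, map_mul, map_pow, MulChar.pow_apply' _ three_ne_zero]
  have h0 : f 0 = 0 := by
    obtain ⟨a, ha⟩ := MulChar.ne_one_iff.1 hχ
    have := hscale 0 a.ne_zero
    rw [mul_zero] at this
    by_contra h
    exact ha (mul_right_cancel₀ h (by rw [one_mul]; exact this.symm))
  have h1 : gaussSum (χ.compNorm L) (ψ.compAddMonoidHom (Algebra.trace F L).toAddMonoidHom) =
      ∑ c, f c * ψ c := by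
    unfold gaussSum
    rw [← Finset.sum_fiberwise (s := Finset.univ) (g := fun y : L => Algebra.trace F L y)]
    refine Finset.sum_congr rfl fun c _ => ?_
    rw [hf, Finset.sum_mul]
    refine Finset.sum_congr rfl fun y hy => ?_
    have : Algebra.trace F L y = c := (Finset.mem_filter.1 hy).2
    rw [← this]
    rfl
  rw [h1]
  change _ = f 1 * _
  unfold gaussSum
  rw [Finset.mul_sum]
  refine Finset.sum_congr rfl fun c _ => ?_
  by_cases hc : c = 0
  · simp [hc, h0, MulChar.map_zero]
  · have := hscale 1 hc
    rw [mul_one] at this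
    rw [this]
    ring

theorem sum_trace_eq_one_mul_sum_trace_eq_one [FiniteDimensional F L] [DecidableEq F]
    (hL : Module.finrank F L = 3) {χ : MulChar F C} (hχ : χ ^ 3 ≠ 1) {ψ : AddChar F C}
    (hψ : ψ ≠ 1) :
    (∑ y : L with Algebra.trace F L y = 1, χ (Algebra.norm F y)) *
      (∑ y : L with Algebra.trace F L y = 1, χ⁻¹ (Algebra.norm F y)) =
      (Fintype.card F : C) ^ 2 := by
  have hχ1 : χ⁻¹ ^ 3 ≠ 1 := by rwa [inv_pow, inv_ne_one]
  have hc : χ.compNorm L ≠ 1 := by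
    obtain ⟨a, ha⟩ := MulChar.ne_one_iff.1 hχ
    intro h
    have := congrArg (fun η => η (algebraMap F L a)) h
    simp only [MulChar.compNorm_apply, Algebra.norm_algebraMap, hL] at this
    rw [MulChar.one_apply ((a.isUnit).map (algebraMap F L)), map_pow,
      ← MulChar.pow_apply' _ three_ne_zero] at this
    exact ha this
  set ψL := ψ.compAddMonoidHom (Algebra.trace F L).toAddMonoidHom with hψL
  have hψL1 : ψL ≠ 1 := by
    intro h
    refine hψ (DFunLike.ext _ _ fun x => ?_)
    obtain ⟨y, rfl⟩ := Algebra.trace_surjective F L x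
    exact congrArg (fun η => η y) h
  have h1 := gaussSum_compNorm (L := L) hL hχ ψ
  have h2 := gaussSum_compNorm (L := L) hL hχ1 ψ⁻¹
  have h3 := gaussSum_mul_gaussSum_eq_card hχ (AddChar.IsPrimitive.of_ne_one hψ)
  have h4 := gaussSum_mul_gaussSum_eq_card hc (AddChar.IsPrimitive.of_ne_one hψL1)
  have h5 : ψ⁻¹.compAddMonoidHom (Algebra.trace F L).toAddMonoidHom = ψL⁻¹ := by
    ext y
    simp [hψL]
  rw [h5] at h2
  rw [MulChar.compNorm_inv, h1, h2, inv_pow, Module.card_eq_pow_finrank (K := F), hL] at h4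
  have hq : (Fintype.card F : C) ≠ 0 := by
    simp
  refine mul_right_cancel₀ hq ?_
  push_cast at h4
  linear_combination h4 - (∑ y : L with Algebra.trace F L y = 1, χ (Algebra.norm F y)) *
    (∑ y : L with Algebra.trace F L y = 1, χ⁻¹ (Algebra.norm F y)) * h3

theorem sum_trace_eq_one_pow_three [FiniteDimensional F L] [DecidableEq F] (χ : MulChar F C) :
    (∑ y : L with Algebra.trace F L y = 1, (χ ^ 3) (Algebra.norm F y)) =
      ∑ y : L with Algebra.trace F L y = 1, χ (Algebra.norm F y) := by
  have : CharP L 3 := charP_of_injective_algebraMap (algebraMap F L).injective 3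
  have hb : Function.Bijective fun x : L => x ^ 3 :=
    PerfectRing.bijective_frobenius (R := L) (p := 3)
  rw [Finset.sum_filter, Finset.sum_filter,
    ← hb.sum_comp fun y => if Algebra.trace F L y = 1 then χ (Algebra.norm F y) else 0]
  refine Finset.sum_congr rfl fun y _ => ?_
  have h1 : Algebra.trace F L (y ^ 3) = 1 ↔ Algebra.trace F L y = 1 := by
    rw [FiniteField.trace_pow_char]
    constructor
    · intro h
      exact (PerfectRing.bijective_frobenius (R := F) (p := 3)).1 (by simpa using h)
    · intro h
      rw [h, one_pow]
  simp only [h1, map_pow, MulChar.pow_apply' _ three_ne_zero]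

end

/-! ### The sign function attached to a quartic character. -/

theorem Nat.four_mul_nine_pow_sub_one_div_four (e : ℕ) : 4 * ((9 ^ e - 1) / 4) = 9 ^ e - 1 := by
  refine Nat.mul_div_cancel' ?_
  have h := Nat.sub_dvd_pow_sub_pow 9 1 e
  rw [one_pow] at h
  exact (by norm_num : 4 ∣ 9 - 1).trans h

theorem exists_two_mul_sign_eq {F C : Type*} [Field F] [Fintype F] [CharP F 3] [Field C] [CharZero C]
    {χ : MulChar F C} (h4 : χ ^ 4 = 1) {I : C} (hI : I ^ 2 = -1) :
    ∃ θ : F → ℤ, (∀ x, x ≠ 0 → θ x = 1 ∨ θ x = -1) ∧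
      ∀ x, 2 * (θ x : C) = (1 - I) * χ x + (1 + I) * χ⁻¹ x := by
  classical
  refine ⟨fun x => if x = 0 then 0 else if χ x = 1 ∨ χ x = I then 1 else -1, ?_, ?_⟩
  · intro x hx
    simp only [hx, if_false]
    split_ifs <;> simp
  · intro x
    by_cases hx : x = 0
    · simp [hx, MulChar.map_zero]
    have hz : χ x ^ 4 = 1 := by
      rw [← MulChar.pow_apply' _ four_ne_zero, h4, MulChar.one_apply (Ne.isUnit hx)]
    have hinv : χ⁻¹ x = χ x ^ 3 := by
      rw [← mulChar_cube_eq_inv h4, MulChar.pow_apply' _ three_ne_zero]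
    simp only [hx, if_false]
    rw [hinv]
    generalize χ x = z at hz
    have h11 : (-1 : C) ≠ 1 := by norm_num
    have hI1 : I ≠ 1 := by
      rintro rfl
      rw [one_pow] at hI
      exact h11 hI.symm
    have hI2 : I ≠ -1 := by
      rintro rfl
      exact h11 (by rw [← hI]; norm_num)
    have hI0 : I ≠ 0 := by
      rintro rfl
      norm_num at hI
    have hprod : (z - 1) * ((z + 1) * ((z - I) * (z + I))) = 0 := by
      linear_combination hz - (z ^ 2 - 1) * hI
    rcases mul_eq_zero.1 hprod with h | h
    · obtain rfl : z = 1 := by linear_combination h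
      simp
      ring
    rcases mul_eq_zero.1 h with h | h
    · obtain rfl : z = -1 := by linear_combination h
      rw [if_neg (by rintro (h | h); exacts [h11 h, hI2 h.symm])]
      push_cast
      ring
    rcases mul_eq_zero.1 h with h | h
    · obtain rfl : z = I := by linear_combination h
      rw [if_pos (Or.inr rfl)]
      push_cast
      linear_combination (2 - z - z ^ 2) * hI
    · obtain rfl : z = -I := by linear_combination h
      rw [if_neg]
      · push_cast
        linear_combination (I + I ^ 2 - 2) * hI
      · rintro (h | h)
        · exact hI2 (by linear_combination -h)
        · refine hI0 ?_
          have : 2 * I = 0 := by linear_combination -h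
          simpa using this

section

variable {F C Γ : Type*} [Field F] [Fintype F] [CharP F 3] [Field C] [CharZero C]
  [LinearOrderedCommGroupWithZero Γ] {v : Valuation C Γ} {φ : WittVector 3 F →+* C}

theorem quarticChar_pow_four {e : ℕ} (hF : Fintype.card F = 9 ^ e) :
    (invTeichmuller φ ^ ((9 ^ e - 1) / 4)) ^ 4 = 1 := by
  rw [← pow_mul, mul_comm, Nat.four_mul_nine_pow_sub_one_div_four, ← hF,
    MulChar.pow_card_sub_one_eq_one]

theorem quarticChar_sq_ne_one (hφ : ∀ w, v (φ w) ≤ 1) {e : ℕ} (he : 0 < e)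
    (hF : Fintype.card F = 9 ^ e) : (invTeichmuller φ ^ ((9 ^ e - 1) / 4)) ^ 2 ≠ 1 := by
  rw [← pow_mul]
  refine invTeichmuller_pow_ne_one hφ fun h => ?_
  have h4 := Nat.four_mul_nine_pow_sub_one_div_four e
  have h9 : 9 ≤ 9 ^ e := Nat.le_self_pow he.ne' 9
  rw [hF] at h
  have := Nat.le_of_dvd (by omega) h
  omega

theorem valuation_sum_quarticChar_cubic_le [IsAlgClosed C] (hφ : ∀ w, v (φ w) ≤ 1) (h3 : v 3 < 1)
    (h30 : v 3 ≠ 0) {e : ℕ} (he : 0 < e) (hF : Fintype.card F = 9 ^ e) {a : F} (ha : a ≠ 0)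
    (b c d : F) :
    v (∑ t, (invTeichmuller φ ^ ((9 ^ e - 1) / 4)) (a * t ^ 3 + b * t ^ 2 + c * t + d)) ≤ v 3 ^ e ∧
    v (∑ t, (invTeichmuller φ ^ ((9 ^ e - 1) / 4))⁻¹ (a * t ^ 3 + b * t ^ 2 + c * t + d)) ≤
      v 3 ^ e := by
  obtain ⟨ψ, hψ1, hψ3⟩ := exists_addChar_pow_three F C
  have hq4 := quarticChar_pow_four (φ := φ) hF
  have hq2 := quarticChar_sq_ne_one hφ he hF
  have hG := valuation_gaussSum_mul_gaussSum_le hφ h3 hψ1 hψ3 he hF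
  set n := (9 ^ e - 1) / 4
  set χ := invTeichmuller φ ^ n with hχ
  have hq : v (Fintype.card F : C) = (v 3 ^ e) ^ 2 := by
    rw [hF, ← pow_mul, mul_comm, pow_mul, ← map_pow, ← map_pow]
    norm_num
  have hK (a b : F) (hb : b ≠ 0) : v (∑ x, χ x * ψ (a * x + b * x⁻¹)) ≤ v 3 ^ e := by
    refine valuation_twisted_kloosterman_le hφ hψ1 (fun j => ?_) a hb
    rw [hχ, ← pow_add]
    exact hG j
  have hK' (a b : F) (hb : b ≠ 0) : v (∑ x, χ⁻¹ x * ψ (a * x + b * x⁻¹)) ≤ v 3 ^ e := by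
    refine valuation_twisted_kloosterman_le hφ hψ1 (fun j => ?_) a hb
    -- Since χ⁻¹ = χ³, starting from exponent j + 3n turns the pair into ω^j χ⁻¹ and ω^j.
    have h := hG (j + 3 * n)
    have h1 : invTeichmuller φ ^ (j + 3 * n) = invTeichmuller φ ^ j * χ⁻¹ := by
      rw [pow_add, mul_comm 3, pow_mul, ← hχ, mulChar_cube_eq_inv hq4]
    rwa [pow_add _ (j + 3 * n), h1, ← hχ, inv_mul_cancel_right, mul_comm] at h
  exact ⟨valuation_sum_mulChar_cubic_le hq4 hq2 hψ1 hψ3 (pow_ne_zero _ h30) hq hK' ha b c d,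
    valuation_sum_mulChar_cubic_le (by rw [inv_pow, hq4, inv_one])
      (by rwa [inv_pow, inv_ne_one]) hψ1 hψ3 (pow_ne_zero _ h30) hq (by rwa [inv_inv]) ha b c d⟩

end

theorem exists_sign_function {F L : Type*} [Field F] [Fintype F] [DecidableEq F] [CharP F 3]
    [Field L] [Fintype L] [Algebra F L] (hL : Module.finrank F L = 3) {e : ℕ} (he : 0 < e)
    (hF : Fintype.card F = 9 ^ e) :
    ∃ θ : F → ℤ, (∀ x, x ≠ 0 → θ x = 1 ∨ θ x = -1) ∧
      (∀ a b c d, a ≠ 0 → (3 : ℤ) ^ e ∣ ∑ t, θ (a * t ^ 3 + b * t ^ 2 + c * t + d)) ∧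
      (∑ y : L with Algebra.trace F L y = 1, θ (Algebra.norm F y)) ^ 2 = (9 ^ e) ^ 2 := by
  obtain ⟨C, _, _, _, Γ, _, v, φ, h3, hφ⟩ := WittVector.exists_valuation F
  have h30 : v 3 ≠ 0 := by simp
  obtain ⟨I, hI⟩ := IsAlgClosed.exists_pow_nat_eq (-1 : C) (n := 2) (by norm_num)
  obtain ⟨ψ, hψ1, -⟩ := exists_addChar_pow_three F C
  have hq4 := quarticChar_pow_four (φ := φ) hF
  have hq2 := quarticChar_sq_ne_one hφ he hF
  have hcub {a : F} (ha : a ≠ 0) (b c d : F) :=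
    valuation_sum_quarticChar_cubic_le hφ h3 h30 he hF ha b c d
  set χ := invTeichmuller φ ^ ((9 ^ e - 1) / 4)
  obtain ⟨θ, hθ1, hθ⟩ := exists_two_mul_sign_eq hq4 hI
  refine ⟨θ, hθ1, fun a b c d ha => ?_, ?_⟩
  · refine v.pow_dvd_of_le φ hφ h3 h30 ?_
    have hv2 : v (2 : C) = 1 := by
      simpa using v.natCast_eq_one_of_not_dvd φ hφ (n := 2) (by norm_num)
    have hvI : v I ≤ 1 :=
      (v.map_eq_one_of_pow_eq_one four_ne_zero
        (by linear_combination (I ^ 2 - 1) * hI : I ^ 4 = 1)).le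
    have h : (2 : C) * ((∑ t, θ (a * t ^ 3 + b * t ^ 2 + c * t + d) : ℤ) : C) =
        (1 - I) * ∑ t, χ (a * t ^ 3 + b * t ^ 2 + c * t + d) +
        (1 + I) * ∑ t, χ⁻¹ (a * t ^ 3 + b * t ^ 2 + c * t + d) := by
      push_cast
      rw [Finset.mul_sum, Finset.mul_sum, Finset.mul_sum, ← Finset.sum_add_distrib]
      exact Finset.sum_congr rfl fun t _ => hθ _
    rw [← one_mul (v _), ← hv2, ← map_mul, h]
    refine v.map_add_le ?_ ?_
    · rw [map_mul]
      exact mul_le_of_le_one_of_le (v.map_sub_le (by simp) hvI) (hcub ha b c d).1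
    · rw [map_mul]
      exact mul_le_of_le_one_of_le (v.map_add_le (by simp) hvI) (hcub ha b c d).2
  · have h3' : χ ^ 3 ≠ 1 := by
      intro h
      refine hq2 ?_
      have h1 : χ = 1 := by rw [← hq4, pow_succ, h, one_mul]
      rw [h1, one_pow]
    have hT := sum_trace_eq_one_mul_sum_trace_eq_one (L := L) hL h3' hψ1
    have hT3 := sum_trace_eq_one_pow_three (L := L) χ
    rw [mulChar_cube_eq_inv hq4] at hT3
    have h : (2 : C) * ((∑ y : L with Algebra.trace F L y = 1, θ (Algebra.norm F y) : ℤ) : C) =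
        (1 - I) * (∑ y : L with Algebra.trace F L y = 1, χ (Algebra.norm F y)) +
        (1 + I) * ∑ y : L with Algebra.trace F L y = 1, χ⁻¹ (Algebra.norm F y) := by
      push_cast
      rw [Finset.mul_sum, Finset.mul_sum, Finset.mul_sum, ← Finset.sum_add_distrib]
      exact Finset.sum_congr rfl fun y _ => hθ _
    rw [hT3] at h hT
    have h' : ((∑ y : L with Algebra.trace F L y = 1, θ (Algebra.norm F y) : ℤ) : C) =
        ∑ y : L with Algebra.trace F L y = 1, χ (Algebra.norm F y) := by
      refine mul_left_cancel₀ (two_ne_zero (α := C)) ?_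
      rw [h]
      ring
    rw [← h', hF] at hT
    have : (((∑ y : L with Algebra.trace F L y = 1, θ (Algebra.norm F y)) ^ 2 : ℤ) : C) =
        ((9 ^ e) ^ 2 : ℤ) := by
      push_cast at hT ⊢
      rw [pow_two, hT]
    exact_mod_cast this

/-! ### Second moment of line sums. -/

section SignFunction

theorem two_mul_card_filter_eq_one {ι : Type*} [Fintype ι] {s : ι → ℤ}
    (hs : ∀ i, s i = 1 ∨ s i = -1) :
    2 * ((Finset.univ.filter fun i => s i = 1).card : ℤ) = Fintype.card ι + ∑ i, s i := by
  rw [Finset.card_filter, Fintype.card_eq_sum_ones]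
  push_cast
  rw [Finset.mul_sum, ← Finset.sum_add_distrib]
  refine Finset.sum_congr rfl fun i _ => ?_
  rcases hs i with h | h <;> simp [h]

variable {F V : Type*} [Field F] [Fintype F] [AddCommGroup V] [Module F V] [Fintype V]

/-- For t ≠ u the pair (P + tw, P + uw) runs once through all pairs of points. -/
theorem sum_sum_add_smul_mul_add_smul (s : V → ℤ) {t u : F} (h : t ≠ u) :
    ∑ w, ∑ P, s (P + t • w) * s (P + u • w) = (∑ P, s P) ^ 2 := by
  have h1 (w : V) : ∑ P, s (P + t • w) * s (P + u • w) = ∑ P, s P * s (P + (u - t) • w) := by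
    rw [← Equiv.sum_comp (Equiv.addRight (t • w)) fun P => s P * s (P + (u - t) • w)]
    refine Finset.sum_congr rfl fun P _ => ?_
    rw [Equiv.coe_addRight, add_assoc, ← add_smul, add_sub_cancel]
  simp only [h1]
  rw [Finset.sum_comm, pow_two, Finset.sum_mul]
  refine Finset.sum_congr rfl fun P _ => ?_
  rw [← Finset.mul_sum]
  congr 1
  exact ((Equiv.smulRight (sub_ne_zero.2 h.symm)).trans (Equiv.addLeft P)).sum_comp s

theorem sum_sum_sq_sum_add_smul {s : V → ℤ} (hs : ∀ P, s P ^ 2 = 1) :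
    ∑ w, ∑ P, (∑ t : F, s (P + t • w)) ^ 2 = Fintype.card F * (Fintype.card V) ^ 2 +
      Fintype.card F * (Fintype.card F - 1) * (∑ P, s P) ^ 2 := by
  classical
  have h1 (w P : V) : (∑ t : F, s (P + t • w)) ^ 2 =
      ∑ t : F, ∑ u : F, s (P + t • w) * s (P + u • w) := by
    rw [pow_two, Finset.sum_mul_sum]
  have h2 : ∑ w, ∑ P, (∑ t : F, s (P + t • w)) ^ 2 =
      ∑ t : F, ∑ u : F, ∑ w, ∑ P, s (P + t • w) * s (P + u • w) := by
    simp only [h1]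
    rw [Finset.sum_congr rfl fun w _ => Finset.sum_comm, Finset.sum_comm]
    refine Finset.sum_congr rfl fun t _ => ?_
    rw [Finset.sum_congr rfl fun w _ => Finset.sum_comm, Finset.sum_comm]
  have h3 (t u : F) : ∑ w, ∑ P, s (P + t • w) * s (P + u • w) =
      (∑ P, s P) ^ 2 + if t = u then (Fintype.card V : ℤ) ^ 2 - (∑ P, s P) ^ 2 else 0 := by
    by_cases h : t = u
    · subst h
      simp [← pow_two, hs]
    · rw [sum_sum_add_smul_mul_add_smul s h, if_neg h, add_zero]
  rw [h2]
  simp only [h3, Finset.sum_add_distrib, Finset.sum_ite_eq, Finset.mem_univ, if_true,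
    Finset.sum_const, Finset.card_univ, nsmul_eq_mul]
  ring

/-- A sign function on a plane with total `±q` all of whose line sums have square at least `q`
has all line sums of square exactly `q`. -/
theorem sq_sum_add_smul_eq {s : V → ℤ} (hV : Fintype.card V = Fintype.card F ^ 2)
    (hs : ∀ P, s P ^ 2 = 1) (hT : (∑ P, s P) ^ 2 = (Fintype.card F : ℤ) ^ 2)
    (h : ∀ P w, w ≠ 0 → (Fintype.card F : ℤ) ≤ (∑ t : F, s (P + t • w)) ^ 2)
    (P : V) {w : V} (hw : w ≠ 0) : (∑ t : F, s (P + t • w)) ^ 2 = Fintype.card F := by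
  classical
  have hsum := sum_sum_sq_sum_add_smul (F := F) hs
  rw [← Fintype.sum_prod_type' fun w P => (∑ t : F, s (P + t • w)) ^ 2] at hsum
  -- The termwise lower bound; the degenerate direction w = 0 contributes (±q)² exactly. Its total
  -- equals the second moment, so equality holds term by term.
  let g : V × V → ℤ := fun x =>
    if x.1 = 0 then (Fintype.card F : ℤ) ^ 2 else Fintype.card F
  have hg : ∑ x, g x = ∑ x : V × V, (∑ t : F, s (x.2 + t • x.1)) ^ 2 := by
    rw [hsum, hT, hV, Fintype.sum_prod_type]
    have h1 (w : V) : (∑ P : V, g (w, P)) = (Fintype.card F : ℤ) ^ 2 * Fintype.card F +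
        if w = 0 then (Fintype.card F : ℤ) ^ 2 * (Fintype.card F ^ 2 - Fintype.card F) else 0 := by
      by_cases hw : w = 0
      · simp [g, hw, hV]
        ring
      · simp [g, hw, hV]
    simp only [h1, Finset.sum_add_distrib, Finset.sum_ite_eq', Finset.mem_univ, if_true,
      Finset.sum_const, Finset.card_univ, nsmul_eq_mul, hV]
    push_cast
    ring
  have hle : ∀ x ∈ (Finset.univ : Finset (V × V)), g x ≤ (∑ t : F, s (x.2 + t • x.1)) ^ 2 := by
    rintro ⟨w, P⟩ -
    by_cases hw : w = 0
    · simp [g, hw, mul_pow, hs]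
    · simpa [g, hw] using h P w hw
  have := (Finset.sum_eq_sum_iff_of_le hle).1 hg (w, P) (Finset.mem_univ _)
  simpa [g, hw] using this.symm

theorem sum_sum_add_smul (s : V → ℤ) (w : V) :
    ∑ P, ∑ t : F, s (P + t • w) = Fintype.card F * ∑ P, s P := by
  rw [Finset.sum_comm]
  have (t : F) : ∑ P, s (P + t • w) = ∑ P, s P := Equiv.sum_comp (Equiv.addRight (t • w)) s
  simp [this]

end SignFunction

/-! ### From sign functions to two-intersection sets. -/

section Lines

variable {F : Type*} [Field F] {n : ℕ}

theorem IsLine.exists_mem_iff {l : AffineSubspace F (AG n F)} (hl : IsLine l) :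
    ∃ P w : AG n F, w ≠ 0 ∧ ∀ x, x ∈ l ↔ ∃ t : F, P + t • w = x := by
  have hne : (l : Set (AG n F)).Nonempty := by
    rw [AffineSubspace.nonempty_iff_ne_bot]
    rintro rfl
    rw [IsLine, AffineSubspace.direction_bot, finrank_bot] at hl
    exact zero_ne_one hl
  obtain ⟨P, hP⟩ := hne
  obtain ⟨⟨w, hw⟩, hw0, hspan⟩ := finrank_eq_one_iff'.1 hl
  refine ⟨P, w, fun h => hw0 (Subtype.ext h), fun x => ⟨fun hx => ?_, ?_⟩⟩
  · obtain ⟨t, ht⟩ := hspan ⟨x -ᵥ P, AffineSubspace.vsub_mem_direction hx hP⟩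
    refine ⟨t, ?_⟩
    have : t • w = x - P := congrArg Subtype.val ht
    rw [this, add_sub_cancel]
  · rintro ⟨t, rfl⟩
    rw [add_comm]
    exact AffineSubspace.vadd_mem_of_mem_direction (Submodule.smul_mem _ t hw) hP

theorem exists_isLine (P : AG n F) {w : AG n F} (hw : w ≠ 0) :
    ∃ l : AffineSubspace F (AG n F), IsLine l ∧ ∀ x, x ∈ l ↔ ∃ t : F, P + t • w = x := by
  refine ⟨AffineSubspace.mk' P (Submodule.span F {w}), ?_, fun x => ?_⟩
  · rw [IsLine, AffineSubspace.direction_mk', finrank_span_singleton hw]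
  · rw [AffineSubspace.mem_mk', Submodule.mem_span_singleton]
    refine exists_congr fun t => ?_
    rw [vsub_eq_sub, eq_sub_iff_add_eq, add_comm]

theorem ncard_inter_line [Fintype F] {s : AG n F → ℤ} {l : AffineSubspace F (AG n F)}
    {P w : AG n F} (hw : w ≠ 0) (hl : ∀ x, x ∈ l ↔ ∃ t : F, P + t • w = x) :
    ({x | s x = 1} ∩ (l : Set (AG n F))).ncard =
      (Finset.univ.filter fun t : F => s (P + t • w) = 1).card := by
  have h : {x | s x = 1} ∩ (l : Set (AG n F)) =
      (fun t : F => P + t • w) '' ↑(Finset.univ.filter fun t : F => s (P + t • w) = 1) := by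
    ext x
    simp only [Set.mem_inter_iff, Set.mem_ofPred_eq, SetLike.mem_coe, hl, Set.mem_image,
      Finset.coe_filter, Finset.mem_univ, true_and]
    constructor
    · rintro ⟨hx, t, rfl⟩
      exact ⟨t, hx, rfl⟩
    · rintro ⟨t, ht, rfl⟩
      exact ⟨ht, t, rfl⟩
  have hinj : Function.Injective fun t : F => P + t • w := fun t u h =>
    smul_left_injective F hw (add_left_cancel h)
  rw [h, Set.ncard_image_of_injective _ hinj, Set.ncard_coe_finset]

/-- A sign function on the affine plane of order `9 ^ e` with total `- 9 ^ e` whose line sums are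
all divisible by `3 ^ e` yields a two-intersection set. -/
theorem isSetOfType_of_sign_function [Fintype F] {e : ℕ} (he : 0 < e)
    (hF : Fintype.card F = 3 ^ (2 * e)) {s : AG 2 F → ℤ} (hs : ∀ P, s P = 1 ∨ s P = -1)
    (hT : ∑ P, s P = -3 ^ (2 * e))
    (hdvd : ∀ P w, w ≠ 0 → (3 : ℤ) ^ e ∣ ∑ t : F, s (P + t • w)) :
    IsSetOfType ((3 ^ (2 * e) - 3 ^ e) / 2) ((3 ^ (2 * e) + 3 ^ e) / 2) {P | s P = 1} ∧
      {P | s P = 1}.ncard = (3 ^ (4 * e) - 3 ^ (2 * e)) / 2 := by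
  classical
  have hr3 : 3 ≤ 3 ^ e := Nat.le_self_pow he.ne' 3
  have hodd : Odd (3 ^ e) := Odd.pow (by decide)
  have hqr : 3 ^ (2 * e) = 3 ^ e * 3 ^ e := by rw [two_mul, pow_add]
  have hqr' : (3 : ℤ) ^ (2 * e) = 3 ^ e * 3 ^ e := by rw [two_mul, pow_add]
  have hq4 : 3 ^ (4 * e) = 3 ^ e * 3 ^ e * (3 ^ e * 3 ^ e) := by
    rw [← pow_add, ← pow_add]
    congr 1
    ring
  have hr : (3 : ℤ) ^ e = ((3 ^ e : ℕ) : ℤ) := by push_cast; rfl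
  rw [hqr', hr] at hT
  rw [hr] at hdvd
  rw [hqr] at hF
  rw [hqr, hq4]
  generalize 3 ^ e = r at *
  have hcount (P w : AG 2 F) := two_mul_card_filter_eq_one (ι := F) fun t => hs (P + t • w)
  have hV : Fintype.card (AG 2 F) = Fintype.card F ^ 2 := by simp
  have hrr : Odd (r * r) := hodd.mul hodd
  have hS (P w : AG 2 F) (hw : w ≠ 0) : (∑ t : F, s (P + t • w)) ^ 2 = Fintype.card F := by
    refine sq_sum_add_smul_eq hV (fun P => by rcases hs P with h | h <;> simp [h])
      (by rw [hT, hF]; push_cast; ring) (fun P w hw => ?_) P hw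
    obtain ⟨k, hk⟩ := hdvd P w hw
    -- A sum of q signs with q odd is odd, hence nonzero.
    have hk0 : k ≠ 0 := by
      rintro rfl
      have h1 := hcount P w
      rw [hk, mul_zero, hF] at h1
      obtain ⟨m, hm⟩ := hrr
      omega
    rw [hk, hF, mul_pow]
    push_cast
    have hk1 : 0 < k ^ 2 := by positivity
    nlinarith [mul_nonneg (sq_nonneg (r : ℤ)) (Int.sub_nonneg_of_le (Int.add_one_le_of_lt hk1))]
  have hS' (P w : AG 2 F) (hw : w ≠ 0) :
      ∑ t : F, s (P + t • w) = -r ∨ ∑ t : F, s (P + t • w) = r := by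
    have := hS P w hw
    rw [hF] at this
    push_cast at this
    rw [← pow_two] at this
    exact (sq_eq_sq_iff_eq_or_eq_neg.1 this).symm
  have hrle : r ≤ r * r := Nat.le_mul_self r
  have hm {P w : AG 2 F} (h : ∑ t : F, s (P + t • w) = -r) :
      (Finset.univ.filter fun t : F => s (P + t • w) = 1).card = (r * r - r) / 2 := by
    have h1 := hcount P w
    rw [h, hF] at h1
    omega
  have hn {P w : AG 2 F} (h : ∑ t : F, s (P + t • w) = r) :
      (Finset.univ.filter fun t : F => s (P + t • w) = 1).card = (r * r + r) / 2 := by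
    have h1 := hcount P w
    rw [h, hF] at h1
    omega
  -- If all line sums were c, one parallel class would give q² c = -q², so c = -1, against c² = q.
  have hconst (c : ℤ) (hc : c ^ 2 = r * r) : ∃ P w : AG 2 F, w ≠ 0 ∧
      ∑ t : F, s (P + t • w) ≠ c := by
    by_contra! hall
    obtain ⟨w, hw⟩ := exists_ne (0 : AG 2 F)
    have h1 := sum_sum_add_smul (F := F) s w
    rw [Finset.sum_congr rfl fun P _ => hall P w hw, hT] at h1
    simp only [Finset.sum_const, Finset.card_univ, hV, nsmul_eq_mul, hF] at h1
    push_cast at h1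
    have h0 : ((r : ℤ) * r) ^ 2 ≠ 0 := by positivity
    have h2 : c = -1 := mul_left_cancel₀ h0 (by rw [h1]; ring)
    rw [h2] at hc
    have : (3 : ℤ) ≤ r := by exact_mod_cast hr3
    nlinarith
  refine ⟨⟨?_, fun l hl => ?_, ?_, ?_⟩, ?_⟩
  · obtain ⟨k, hk⟩ := hodd
    omega
  · obtain ⟨P, w, hw, hl⟩ := hl.exists_mem_iff
    rw [ncard_inter_line hw hl]
    exact (hS' P w hw).imp hm hn
  · obtain ⟨P, w, hw, h⟩ := hconst r (by ring)
    obtain ⟨l, hl, hmem⟩ := exists_isLine P hw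
    exact ⟨l, hl, by rw [ncard_inter_line hw hmem, hm ((hS' P w hw).resolve_right h)]⟩
  · obtain ⟨P, w, hw, h⟩ := hconst (-r) (by ring)
    obtain ⟨l, hl, hmem⟩ := exists_isLine P hw
    exact ⟨l, hl, by rw [ncard_inter_line hw hmem, hn ((hS' P w hw).resolve_left h)]⟩
  · have h1 := two_mul_card_filter_eq_one hs
    rw [hT, hV, hF] at h1
    have h2 : {P | s P = 1} = ↑(Finset.univ.filter fun P => s P = 1) := by
      ext
      simp
    rw [h2, Set.ncard_coe_finset]
    have h3 (m : ℕ) (h : 2 * (m : ℤ) = ((r * r : ℕ) ^ 2 : ℕ) + -(r * r)) :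
        2 * m + r * r = r * r * (r * r) := by
      zify
      push_cast at h
      linear_combination h
    have h4 := h3 _ h1
    generalize r * r * (r * r) = M at *
    omega

end Lines

/-! ### Assembly on the trace-one hyperplane. -/

theorem exists_plane_sign_function {F L : Type*} [Field F] [Fintype F] [DecidableEq F]
    [CharP F 3] [Field L] [Fintype L] [Algebra F L] (hL : Module.finrank F L = 3) {e : ℕ}
    (he : 0 < e) (hF : Fintype.card F = 9 ^ e) :
    ∃ s : AG 2 F → ℤ, (∀ P, s P = 1 ∨ s P = -1) ∧ (∑ P, s P) ^ 2 = (9 ^ e) ^ 2 ∧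
      ∀ P w, w ≠ 0 → (3 : ℤ) ^ e ∣ ∑ t : F, s (P + t • w) := by
  obtain ⟨θ, hθ, hdvd, hT⟩ := exists_sign_function hL he hF
  obtain ⟨v₀, hv₀⟩ := Algebra.trace_surjective F L 1
  have hker : Module.finrank F (LinearMap.ker (Algebra.trace F L)) = 2 := by
    have h := (Algebra.trace F L).finrank_range_add_finrank_ker
    rw [LinearMap.range_eq_top.2 (Algebra.trace_surjective F L), finrank_top,
      Module.finrank_self, hL] at h
    omega
  let g : AG 2 F ≃ₗ[F] LinearMap.ker (Algebra.trace F L) :=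
    LinearEquiv.ofFinrankEq _ _ (by rw [hker]; simp)
  have hg (P : AG 2 F) : Algebra.trace F L (v₀ + g P) = 1 := by
    rw [map_add, hv₀, LinearMap.mem_ker.1 (g P).2, add_zero]
  refine ⟨fun P => θ (Algebra.norm F (v₀ + g P : L)), fun P => hθ _ ?_, ?_, fun P w hw => ?_⟩
  · rw [Algebra.norm_ne_zero_iff]
    intro h
    have := hg P
    rw [h, map_zero] at this
    exact zero_ne_one this
  · rw [← hT]
    congr 1
    refine Finset.sum_bij (fun P _ => (v₀ + g P : L)) (fun P _ => by simp [hg P]) ?_ ?_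
      fun P _ => rfl
    · intro P _ Q _ h
      exact g.injective (Subtype.ext (add_left_cancel h))
    · intro y hy
      have hy' : Algebra.trace F L y = 1 := (Finset.mem_filter.1 hy).2
      refine ⟨g.symm ⟨y - v₀, ?_⟩, Finset.mem_univ _, ?_⟩
      · rw [LinearMap.mem_ker, map_sub, hy', hv₀, sub_self]
      · simp
  · have hgw : (g w : L) ≠ 0 := fun h => hw (by
      rw [← g.map_eq_zero_iff]
      exact Subtype.ext h)
    obtain ⟨b, c, d, h⟩ := exists_norm_add_smul_eq hL (v₀ + g P : L) hgw
    have h1 (t : F) : (v₀ + g (P + t • w) : L) = v₀ + g P + t • (g w : L) := by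
      rw [map_add, map_smul, Submodule.coe_add, Submodule.coe_smul, add_assoc]
    simp only [h1, h]
    exact hdvd _ b c d (Algebra.norm_ne_zero_iff.2 hgw)

theorem mainTheorem4 (e : ℕ) (he : 0 < e) (F : Type*) [Field F] [Finite F]
    (hF : Nat.card F = 3 ^ (2 * e)) :
    ∃ K : Set (AG 2 F),
      IsSetOfType ((3 ^ (2 * e) - 3 ^ e) / 2) ((3 ^ (2 * e) + 3 ^ e) / 2) K ∧
      K.ncard = (3 ^ (4 * e) - 3 ^ (2 * e)) / 2 := by
  classical
  have := Fintype.ofFinite F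
  rw [Nat.card_eq_fintype_card] at hF
  have : CharP F 3 := by
    obtain ⟨p, hp⟩ := CharP.exists F
    obtain ⟨n, hpp, hn⟩ := FiniteField.card F p
    rw [hF] at hn
    have h3 : p ∣ 3 := hpp.dvd_of_dvd_pow (hn ▸ dvd_pow_self p n.ne_zero)
    rwa [← (Nat.prime_dvd_prime_iff_eq hpp Nat.prime_three).1 h3]
  have h9 : 9 ^ e = 3 ^ (2 * e) := by rw [pow_mul]; norm_num
  have h9' : (9 : ℤ) ^ e = 3 ^ (2 * e) := by rw [pow_mul]; norm_num
  have := Fintype.ofFinite (FiniteField.Extension F 3 3)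
  obtain ⟨s, hs, hT, hdvd⟩ := exists_plane_sign_function
    (FiniteField.finrank_extension F 3 3) he (hF.trans h9.symm)
  rw [h9'] at hT
  rcases sq_eq_sq_iff_eq_or_eq_neg.1 hT with h | h
  -- A total of +q calls for the opposite signs, i.e. the complementary set.
  · refine ⟨_, isSetOfType_of_sign_function he hF (s := fun P => -s P) (fun P => ?_) ?_
      fun P w hw => ?_⟩
    · rcases hs P with h | h <;> simp [h]
    · rw [Finset.sum_neg_distrib, h]
    · rw [Finset.sum_neg_distrib, dvd_neg]
      exact hdvd P w hw
  · exact ⟨_, isSetOfType_of_sign_function he hF hs h hdvd⟩
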